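/- **Conventions.** A *locally $C^*$-algebra* is a complete Hausdorff complex topological $*$-algebra $A$ (not necessarily unital) such that a net $(a_i)$ converges to $0$ in $A$ if and only if $p(a_i)\to 0$ for every $p\in S(A)$, where $S(A)$ is the set of continuous $C^*$-seminorms on $A$. $\mathrm{Aut}(A)$ is the group of $*$-automorphisms of $A$ that are continuous together with their inverses. A *Hilbert $A$-module* is a complex vector space $E$ with a compatible right $A$-action and an $A$-valued inner product $\langle\cdot,\cdot\rangle$, $\mathbb C$- and $A$-linear in the second variable, with $\langle\xi,\eta\rangle^*=\langle\eta,\xi\rangle$, $\langle\xi,\xi\rangle\ge 0$, and $\langle\xi,\xi\rangle=0$ only for $\xi=0$, complete for the seminorms $\overline p_E(\xi)=p(\langle\xi,\xi\rangle)^{1/2}$, $p\in S(A)$. It is *full* if the linear span of $\{\langle\xi,\eta\rangle:\xi,\eta\in E\}$ is dense in $A$. $L(E)$ is the $*$-algebra of adjointable module morphisms $E\to E$, with the topology of the seminorms $\widetilde p(T)=\sup\{\overline p_E(T\xi):\overline p_E(\xi)\le 1\}$, $p\in S(A)$, and $K(E)$ is the closure in $L(E)$ of the linear span of the operators $\theta_{\xi,\eta}(\zeta)=\xi\langle\eta,\zeta\rangle$.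 $\mathrm{Aut}(E)$ is the group of bijections $u:E\to E$ such that for each $v\in\{u,u^{-1}\}$ there is a continuous $*$-homomorphism $\alpha:A\to A$ with $\langle v\xi,v\eta\rangle=\alpha(\langle\xi,\eta\rangle)$ for all $\xi,\eta\in E$. Let $G$ be a locally compact group. An *action* of $G$ on $A$ (on $K(E)$, on $E$) is a group homomorphism from $G$ to $\mathrm{Aut}(A)$ ($\mathrm{Aut}(K(E))$, $\mathrm{Aut}(E)$); it is *continuous* if $g\mapsto \alpha_g(a)$ (respectively $g\mapsto u_g(\xi)$) is continuous for each $a$ (respectively $\xi$). An action on a locally $C^*$-algebra $A$ is an *inverse limit action* if $A$ can be written as an inverse limit $\varprojlim_{\lambda} A_\lambda$ of $C^*$-algebras over a directed set so that $\alpha_g=\varprojlim_\lambda\alpha^\lambda_g$ for all $g\in G$, for actions $\alpha^\lambda$ of $G$ on $A_\lambda$. An action $u$ on $E$ is an *inverse limit action* if $E$ can be written as an inverse limit $\varprojlim_\lambda E_\lambda$ of Hilbert $C^*$-modules $E_\lambda$ over $C^*$-algebras $A_\lambda$ with $A=\varprojlim_\lambda A_\lambda$, over a directed set, so that $u_g=\varprojlim_\lambda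 u^\lambda_g$ for all $g\in G$, for actions $u^\lambda$ of $G$ on $E_\lambda$. A *continuous inverse limit action* is a continuous action that is an inverse limit action; for an action $\alpha$ on a locally $C^*$-algebra $A$ it is moreover required that the $p\in S(A)$ with $p\circ\alpha_g=p$ for all $g\in G$ be cofinal in $S(A)$. **Proposition.** Let $G$ be a locally compact group, $A$ a locally $C^*$-algebra, $E$ a full Hilbert $A$-module, and $g\mapsto u_g$ an action of $G$ on $E$. 1. There is a unique action $g\mapsto\alpha^u_g$ of $G$ on $A$ such that $\alpha^u_g(\langle\xi,\eta\rangle)=\langle u_g(\xi),u_g(\eta)\rangle$ for all $g\in G$ and $\xi,\eta\in E$. 2. There is a unique action $g\mapsto\beta^u_g$ of $G$ on $K(E)$ such that $\beta^u_g(\theta_{\xi,\eta})=\theta_{u_g(\xi),u_g(\eta)}$ for all $g\in G$ and $\xi,\eta\in E$. 3. If $u$ is a continuous inverse limit action of $G$ on $E$, then $\alpha^u$ and $\beta^u$ are continuous inverse limit actions of $G$ on $A$ and on $K(E)$ respectively. -/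

import Mathlib

open Filter Topology

universe w v x

noncomputable section

/-! ### Locally C⋆-algebras -/

/-- A continuous C⋆-seminorm on a complex topological ⋆-algebra. -/
structure ContCStarSeminorm (A : Type*) [NonUnitalRing A] [StarRing A] [Module ℂ A]
    [TopologicalSpace A] extends Seminorm ℂ A where
  mul_le' : ∀ a b : A, toFun (a * b) ≤ toFun a * toFun b
  star_mul_self' : ∀ a : A, toFun (star a * a) = toFun a ^ 2
  continuous' : Continuous toFun

namespace ContCStarSeminorm

variable {A : Type*} [NonUnitalRing A] [StarRing A] [Module ℂ A] [TopologicalSpace A]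

instance : FunLike (ContCStarSeminorm A) A ℝ where
  coe p := p.toFun
  coe_injective p q h := by
    rcases p with ⟨p, _, _, _⟩
    rcases q with ⟨q, _, _, _⟩
    congr
    exact DFunLike.coe_injective h

instance : SeminormClass (ContCStarSeminorm A) ℂ A where
  map_zero p := p.map_zero'
  map_add_le_add p := p.add_le'
  map_neg_eq_map p := p.neg'
  map_smul_eq_mul p := p.smul'

theorem mul_le (p : ContCStarSeminorm A) (a b : A) : p (a * b) ≤ p a * p b := p.mul_le' a b

theorem star_mul_self (p : ContCStarSeminorm A) (a : A) : p (star a * a) = p a ^ 2 :=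
  p.star_mul_self' a

theorem map_star (p : ContCStarSeminorm A) (a : A) : p (star a) = p a := by
  have key : ∀ b : A, p b ≤ p (star b) := fun b => by
    have h := p.mul_le (star b) b
    rw [p.star_mul_self] at h
    rcases (apply_nonneg p b).eq_or_lt with h0 | h0
    · rw [← h0]; exact apply_nonneg p _
    · nlinarith
  exact le_antisymm (by simpa using key (star a)) (key a)

end ContCStarSeminorm

/-- A locally C⋆-algebra: a complete Hausdorff complex topological ⋆-algebra (not necessarily
unital) in which a net tends to `0` iff all continuous C⋆-seminorms of it tend to `0`.
(Continuity of the multiplication and of the involution follows from the last condition.) -/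
class IsLocallyCStarAlgebra (A : Type*) [NonUnitalRing A] [StarRing A] [Module ℂ A]
    [UniformSpace A] : Prop extends IsScalarTower ℂ A A, SMulCommClass ℂ A A, StarModule ℂ A,
    IsUniformAddGroup A, CompleteSpace A, T2Space A where
  nhds_zero : 𝓝 (0 : A) = ⨅ p : ContCStarSeminorm A, comap p (𝓝 (0 : ℝ))

/-! ### The C⋆-algebra attached to a continuous C⋆-seminorm -/

namespace ContCStarSeminorm

section Completion

open UniformSpace

variable {A : Type*} [NonUnitalRing A] [StarRing A] [Module ℂ A] [TopologicalSpace A]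

/-- The algebra `A` regarded as seminormed by `p`. -/
def Pre (_p : ContCStarSeminorm A) : Type _ := A

variable (p : ContCStarSeminorm A)

instance : NonUnitalRing p.Pre := inferInstanceAs (NonUnitalRing A)
instance : StarRing p.Pre := inferInstanceAs (StarRing A)
instance : Module ℂ p.Pre := inferInstanceAs (Module ℂ A)
instance [IsScalarTower ℂ A A] : IsScalarTower ℂ p.Pre p.Pre :=
  inferInstanceAs (IsScalarTower ℂ A A)
instance [SMulCommClass ℂ A A] : SMulCommClass ℂ p.Pre p.Pre :=
  inferInstanceAs (SMulCommClass ℂ A A)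
instance [StarModule ℂ A] : StarModule ℂ p.Pre := inferInstanceAs (StarModule ℂ A)

instance : NonUnitalSeminormedRing p.Pre :=
  { (inferInstance : NonUnitalRing p.Pre),
    AddGroupSeminorm.toSeminormedAddCommGroup (E := p.Pre) p.toSeminorm.toAddGroupSeminorm with
    norm_mul_le := p.mul_le }

theorem norm_pre (a : p.Pre) : ‖a‖ = p a := rfl

instance : NormedSpace ℂ p.Pre where
  norm_smul_le c a := (map_smul_eq_mul p c a).le

instance : NormedStarGroup p.Pre where
  norm_star_le a := (p.map_star a).le

/-- The Hausdorff completion of `A` with respect to `p`. -/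
def Compl : Type _ := Completion p.Pre

instance : NormedAddCommGroup p.Compl := inferInstanceAs (NormedAddCommGroup (Completion p.Pre))
instance : NormedSpace ℂ p.Compl := inferInstanceAs (NormedSpace ℂ (Completion p.Pre))
instance : CompleteSpace p.Compl := inferInstanceAs (CompleteSpace (Completion p.Pre))

/-- The canonical map of `A` into its completion with respect to `p`. -/
def toCompl (a : A) : p.Compl := ((show p.Pre from a : p.Pre) : Completion p.Pre)

theorem norm_toCompl (a : A) : ‖p.toCompl a‖ = p a :=
  (Completion.norm_coe (E := p.Pre) a).trans (p.norm_pre a)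

theorem toCompl_add (a b : A) : p.toCompl (a + b) = p.toCompl a + p.toCompl b :=
  Completion.coe_add (α := p.Pre) a b

theorem toCompl_zero : p.toCompl 0 = 0 := rfl

theorem toCompl_smul (c : ℂ) (a : A) : p.toCompl (c • a) = c • p.toCompl a :=
  Completion.coe_smul (X := p.Pre) c a

theorem continuous_coe_pre : Continuous (fun a : p.Pre => p.toCompl a) :=
  Completion.continuous_coe p.Pre

theorem isDenseInducing_coe_pre : IsDenseInducing (fun a : p.Pre => p.toCompl a) :=
  Completion.isDenseInducing_coe

theorem denseRange_toCompl : DenseRange p.toCompl := p.isDenseInducing_coe_pre.dense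

instance : Mul p.Compl :=
  ⟨Function.curry <| (p.isDenseInducing_coe_pre.prodMap p.isDenseInducing_coe_pre).extend
    ((fun a : p.Pre => p.toCompl a) ∘ Function.uncurry (· * ·))⟩

theorem toCompl_mul (a b : A) : p.toCompl (a * b) = p.toCompl a * p.toCompl b :=
  ((p.isDenseInducing_coe_pre.prodMap p.isDenseInducing_coe_pre).extend_eq
    (p.continuous_coe_pre.comp (continuous_mul (M := p.Pre))) (a, b)).symm

instance : ContinuousMul p.Compl where
  continuous_mul := by
    let i : p.Pre →+ p.Compl := ⟨⟨fun a => p.toCompl a, p.toCompl_zero⟩, p.toCompl_add⟩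
    let m := (AddMonoidHom.mul : p.Pre →+ p.Pre →+ p.Pre).compr₂ i
    have : Continuous fun x : p.Pre × p.Pre => m x.1 x.2 :=
      p.continuous_coe_pre.comp continuous_mul
    have di : IsDenseInducing (i : p.Pre → p.Compl) := p.isDenseInducing_coe_pre
    exact (di.extend_Z_bilin di this :)

instance : Star p.Compl := ⟨Completion.map (fun a : p.Pre => star a)⟩

theorem toCompl_star (a : A) : p.toCompl (star a) = star (p.toCompl a) :=
  (Completion.map_coe (f := fun a : p.Pre => star a) (star_isometry (E := p.Pre)).uniformContinuous
    a).symm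

instance : ContinuousStar p.Compl :=
  ⟨Completion.continuous_map (f := fun a : p.Pre => star a)⟩

@[elab_as_elim]
theorem compl_induction {P : p.Compl → Prop} (x : p.Compl) (hP : IsClosed {x | P x})
    (h : ∀ a : A, P (p.toCompl a)) : P x :=
  p.denseRange_toCompl.induction_on x hP h

@[elab_as_elim]
theorem compl_induction₂ {P : p.Compl → p.Compl → Prop} (x y : p.Compl)
    (hP : IsClosed {x : p.Compl × p.Compl | P x.1 x.2})
    (h : ∀ a b : A, P (p.toCompl a) (p.toCompl b)) : P x y :=
  p.denseRange_toCompl.induction_on₂ hP h x y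

@[elab_as_elim]
theorem compl_induction₃ {P : p.Compl → p.Compl → p.Compl → Prop} (x y z : p.Compl)
    (hP : IsClosed {x : p.Compl × p.Compl × p.Compl | P x.1 x.2.1 x.2.2})
    (h : ∀ a b c : A, P (p.toCompl a) (p.toCompl b) (p.toCompl c)) : P x y z :=
  p.denseRange_toCompl.induction_on₃ hP h x y z

theorem compl_mul_assoc (x y z : p.Compl) : x * y * z = x * (y * z) :=
  p.compl_induction₃ x y z (isClosed_eq (by fun_prop) (by fun_prop))
    fun a b c => by simp only [← toCompl_mul, mul_assoc]

theorem compl_mul_add (x y z : p.Compl) : x * (y + z) = x * y + x * z :=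
  p.compl_induction₃ x y z (isClosed_eq (by fun_prop) (by fun_prop))
    fun a b c => by simp only [← toCompl_mul, ← toCompl_add, mul_add]

theorem compl_add_mul (x y z : p.Compl) : (x + y) * z = x * z + y * z :=
  p.compl_induction₃ x y z (isClosed_eq (by fun_prop) (by fun_prop))
    fun a b c => by simp only [← toCompl_mul, ← toCompl_add, add_mul]

theorem compl_norm_mul_le (x y : p.Compl) : ‖x * y‖ ≤ ‖x‖ * ‖y‖ :=
  p.compl_induction₂ x y (isClosed_le (by fun_prop) (by fun_prop))
    fun a b => by simpa only [← toCompl_mul, norm_toCompl] using p.mul_le a b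

theorem compl_star_star (x : p.Compl) : star (star x) = x :=
  p.compl_induction x (isClosed_eq (by fun_prop) (by fun_prop))
    fun a => by simp only [← toCompl_star, star_star]

theorem compl_star_mul (x y : p.Compl) : star (x * y) = star y * star x :=
  p.compl_induction₂ x y (isClosed_eq (by fun_prop) (by fun_prop))
    fun a b => by simp only [← toCompl_star, ← toCompl_mul, star_mul]

theorem compl_star_add (x y : p.Compl) : star (x + y) = star x + star y :=
  p.compl_induction₂ x y (isClosed_eq (by fun_prop) (by fun_prop))
    fun a b => by simp only [← toCompl_star, ← toCompl_add, star_add]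

theorem compl_norm_mul_self_le (x : p.Compl) : ‖x‖ * ‖x‖ ≤ ‖star x * x‖ :=
  p.compl_induction x (isClosed_le (by fun_prop) (by fun_prop))
    fun a => by
      rw [← toCompl_star, ← toCompl_mul, norm_toCompl, norm_toCompl, p.star_mul_self, sq]

theorem compl_continuous_smul (c : ℂ) : Continuous fun x : p.Compl => c • x :=
  continuous_const_smul (T := Completion p.Pre) c

theorem compl_smul_mul [IsScalarTower ℂ A A] (c : ℂ) (x y : p.Compl) :
    (c • x) * y = c • (x * y) :=
  p.compl_induction₂ x y
    (isClosed_eq (((p.compl_continuous_smul c).comp continuous_fst).mul continuous_snd)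
      ((p.compl_continuous_smul c).comp continuous_mul))
    fun a b => by rw [← toCompl_mul, ← toCompl_smul, ← toCompl_smul, ← toCompl_mul, smul_mul_assoc]

theorem compl_mul_smul [SMulCommClass ℂ A A] (c : ℂ) (x y : p.Compl) :
    x * (c • y) = c • (x * y) :=
  p.compl_induction₂ x y
    (isClosed_eq (continuous_fst.mul ((p.compl_continuous_smul c).comp continuous_snd))
      ((p.compl_continuous_smul c).comp continuous_mul))
    fun a b => by rw [← toCompl_mul, ← toCompl_smul, ← toCompl_smul, ← toCompl_mul, mul_smul_comm]

theorem compl_star_smul [StarModule ℂ A] (c : ℂ) (x : p.Compl) : star (c • x) = star c • star x :=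
  p.compl_induction x
    (isClosed_eq (continuous_star.comp (p.compl_continuous_smul c))
      ((p.compl_continuous_smul (star c)).comp continuous_star))
    fun a => by rw [← toCompl_smul, ← toCompl_star, ← toCompl_star, ← toCompl_smul, star_smul]

/-- The completion of `A` with respect to a continuous C⋆-seminorm is a C⋆-algebra. -/
instance [IsScalarTower ℂ A A] [SMulCommClass ℂ A A] [StarModule ℂ A] :
    NonUnitalCStarAlgebra p.Compl where
  __ := (inferInstance : NormedAddCommGroup p.Compl)
  __ := (inferInstance : NormedSpace ℂ p.Compl)
  __ := (inferInstance : CompleteSpace p.Compl)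
  __ := (inferInstance : Mul p.Compl)
  __ := (inferInstance : Star p.Compl)
  zero_mul x := by simpa using p.compl_add_mul 0 0 x
  mul_zero x := by simpa using p.compl_mul_add x 0 0
  mul_assoc := p.compl_mul_assoc
  left_distrib := p.compl_mul_add
  right_distrib := p.compl_add_mul
  norm_mul_le := p.compl_norm_mul_le
  star_involutive := p.compl_star_star
  star_mul := p.compl_star_mul
  star_add := p.compl_star_add
  norm_mul_self_le := p.compl_norm_mul_self_le
  smul_assoc := p.compl_smul_mul
  smul_comm c x y := (p.compl_mul_smul c x y).symm
  star_smul := p.compl_star_smul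

end Completion

end ContCStarSeminorm

/-! ### Hilbert modules over locally C⋆-algebras -/

/-- A Hilbert `A`-module: a complex vector space `E` with a compatible right `A`-action `rmul` and
an `A`-valued inner product, linear in the second variable, such that `E` is complete in the
topology given by the seminorms `ξ ↦ √(p ⟨ξ, ξ⟩)`, `p` a continuous C⋆-seminorm on `A`. Over a
C⋆-algebra this is a Hilbert C⋆-module. An element of `A` is positive if it is of the form
`star b * b`. -/
class HilbertModule (A E : Type*) [NonUnitalRing A] [StarRing A] [Module ℂ A] [UniformSpace A]
    [AddCommGroup E] [Module ℂ E] [UniformSpace E] extends Inner A E where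
  rmul : E → A → E
  rmul_add : ∀ (ξ : E) (a b : A), rmul ξ (a + b) = rmul ξ a + rmul ξ b
  add_rmul : ∀ (ξ η : E) (a : A), rmul (ξ + η) a = rmul ξ a + rmul η a
  rmul_mul : ∀ (ξ : E) (a b : A), rmul ξ (a * b) = rmul (rmul ξ a) b
  smul_rmul : ∀ (c : ℂ) (ξ : E) (a : A), rmul (c • ξ) a = c • rmul ξ a
  rmul_smul : ∀ (c : ℂ) (ξ : E) (a : A), rmul ξ (c • a) = c • rmul ξ a
  inner_add_right : ∀ ξ η ζ : E, inner ξ (η + ζ) = inner ξ η + inner ξ ζ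
  inner_smul_right : ∀ (c : ℂ) (ξ η : E), inner ξ (c • η) = c • inner ξ η
  inner_rmul_right : ∀ (ξ η : E) (a : A), inner ξ (rmul η a) = inner ξ η * a
  star_inner : ∀ ξ η : E, star (inner ξ η) = inner η ξ
  inner_self_nonneg : ∀ ξ : E, ∃ b : A, inner ξ ξ = star b * b
  inner_self_eq_zero : ∀ ξ : E, inner ξ ξ = 0 ↔ ξ = 0
  isUniformAddGroup : IsUniformAddGroup E
  nhds_zero : 𝓝 (0 : E) =
    ⨅ p : ContCStarSeminorm A, comap (fun ξ : E => √(p (inner ξ ξ))) (𝓝 (0 : ℝ))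
  complete : CompleteSpace E

namespace HilbertModule

variable (A : Type*) {E : Type*} [NonUnitalRing A] [StarRing A] [Module ℂ A] [UniformSpace A]
  [AddCommGroup E] [Module ℂ E] [UniformSpace E] [HilbertModule A E]

variable (E) in
/-- `E` is full: the linear span of the inner products is dense in `A`. -/
def IsFull : Prop :=
  Dense (Submodule.span ℂ (Set.range fun x : E × E => inner A x.1 x.2) : Set A)

variable {A}

/-- The seminorm `ξ ↦ √(p ⟨ξ, ξ⟩)` on `E`. -/
def bar (p : ContCStarSeminorm A) (ξ : E) : ℝ := √(p (inner A ξ ξ))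

theorem bar_nonneg (p : ContCStarSeminorm A) (ξ : E) : 0 ≤ bar p ξ := Real.sqrt_nonneg _

theorem bar_sq (p : ContCStarSeminorm A) (ξ : E) : bar p ξ ^ 2 = p (inner A ξ ξ) :=
  Real.sq_sqrt (apply_nonneg p _)

variable (A) in
theorem inner_add_left (ξ η ζ : E) : inner A (ξ + η) ζ = inner A ξ ζ + inner A η ζ := by
  rw [← star_inner, inner_add_right, star_add, star_inner, star_inner]

theorem inner_rmul_left (ξ η : E) (a : A) : inner A (rmul ξ a) η = star a * inner A ξ η := by
  rw [← star_inner, inner_rmul_right, star_mul, star_inner]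

variable (A) in
theorem inner_zero_right (ξ : E) : inner A ξ (0 : E) = 0 := by
  simpa using inner_smul_right (A := A) (0 : ℂ) ξ 0

variable (A) in
theorem inner_sub_right (ξ η ζ : E) : inner A ξ (η - ζ) = inner A ξ η - inner A ξ ζ := by
  rw [eq_sub_iff_add_eq, ← inner_add_right, sub_add_cancel]

variable (A) in
theorem inner_sub_left (ξ η ζ : E) : inner A (ξ - η) ζ = inner A ξ ζ - inner A η ζ := by
  rw [eq_sub_iff_add_eq, ← inner_add_left, sub_add_cancel]

variable (A) in
theorem ext_inner_left {ξ η : E} (h : ∀ ζ : E, inner A ζ ξ = inner A ζ η) : ξ = η := by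
  rw [← sub_eq_zero, ← inner_self_eq_zero (A := A), inner_sub_right, h, sub_self]

variable (A) in
theorem ext_inner_right {ξ η : E} (h : ∀ ζ : E, inner A ξ ζ = inner A η ζ) : ξ = η :=
  ext_inner_left A fun ζ => by rw [← star_inner, h, star_inner]

section StarModule

variable [StarModule ℂ A]

variable (A) in
theorem inner_smul_left (c : ℂ) (ξ η : E) : inner A (c • ξ) η = star c • inner A ξ η := by
  rw [← star_inner, inner_smul_right, star_smul, star_inner]

theorem bar_smul (p : ContCStarSeminorm A) (c : ℂ) (ξ : E) : bar p (c • ξ) = ‖c‖ * bar p ξ := by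
  rw [bar, inner_smul_right, inner_smul_left, map_smul_eq_mul, map_smul_eq_mul, norm_star,
    ← mul_assoc, Real.sqrt_mul (by positivity), Real.sqrt_mul_self (norm_nonneg _)]
  rfl

theorem bar_neg (p : ContCStarSeminorm A) (ξ : E) : bar p (-ξ) = bar p ξ := by
  simpa using bar_smul p (-1) ξ

variable [IsScalarTower ℂ A A] [SMulCommClass ℂ A A]

/-- The Cauchy–Schwarz inequality. -/
theorem apply_inner_le (p : ContCStarSeminorm A) (ξ η : E) :
    p (inner A ξ η) ≤ bar p ξ * bar p η := by
  let _ := CStarAlgebra.spectralOrder p.Compl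
  have := CStarAlgebra.spectralOrderedRing p.Compl
  have hpos : ∀ ζ : E, 0 ≤ p.toCompl (inner A ζ ζ) := fun ζ => by
    obtain ⟨b, hb⟩ := inner_self_nonneg (A := A) ζ
    rw [hb, p.toCompl_mul, p.toCompl_star]
    exact star_mul_self_nonneg (p.toCompl b)
  have key : ∀ M : ℝ, 0 < M → p (inner A ξ ξ) ≤ M →
      p (inner A ξ η) ^ 2 ≤ M * p (inner A η η) := by
    intro M hM hN
    set x := inner A ξ η with hx
    set X := p.toCompl x with hX
    set C := p.toCompl (inner A η η) with hC
    have h1 : inner A (rmul ξ x - (M : ℂ) • η) (rmul ξ x - (M : ℂ) • η) +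
        ((M : ℂ) • (star x * x) + (M : ℂ) • (star x * x)) =
        star x * inner A ξ ξ * x + (M : ℂ) • ((M : ℂ) • inner A η η) := by
      have hs : star x = inner A η ξ := star_inner _ _
      simp only [inner_sub_right, inner_sub_left, inner_rmul_right, inner_rmul_left,
        inner_smul_right, inner_smul_left, ← hx, hs, sub_mul, smul_mul_assoc, smul_sub,
        RCLike.star_def, Complex.conj_ofReal]
      abel
    have h2 := congrArg p.toCompl h1
    simp only [p.toCompl_add, p.toCompl_smul, p.toCompl_mul, p.toCompl_star, ← hX, ← hC] at h2
    have h3 : star X * p.toCompl (inner A ξ ξ) * X ≤ (M : ℝ) • (star X * X) := by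
      refine (CStarAlgebra.star_left_conjugate_le_norm_smul
        (hb := IsSelfAdjoint.of_nonneg (hpos ξ))).trans ?_
      rw [p.norm_toCompl]
      exact smul_le_smul_of_nonneg_right hN (star_mul_self_nonneg _)
    have h4 : (M : ℝ) • (star X * X) + (M : ℝ) • (star X * X) ≤
        (M : ℝ) • (star X * X) + (M : ℝ) • ((M : ℝ) • C) := by
      have h5 : (M : ℝ) • (star X * X) + (M : ℝ) • (star X * X) ≤
          star X * p.toCompl (inner A ξ ξ) * X + (M : ℝ) • ((M : ℝ) • C) := by
        have h6 := hpos (rmul ξ x - (M : ℂ) • η)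
        simp only [Complex.coe_smul] at h2
        rw [← h2]
        exact le_add_of_nonneg_left h6
      exact h5.trans (add_le_add_left h3 _)
    have h7 : star X * X ≤ (M : ℝ) • C :=
      (smul_le_smul_iff_of_pos_left hM).1 (le_of_add_le_add_left h4)
    have h8 := CStarAlgebra.norm_le_norm_of_nonneg_of_le (star_mul_self_nonneg X) h7
    rw [CStarRing.norm_star_mul_self, norm_smul, Real.norm_of_nonneg hM.le, hX, hC,
      p.norm_toCompl, p.norm_toCompl] at h8
    rw [sq]
    exact h8
  have h9 : p (inner A ξ η) ^ 2 ≤ p (inner A ξ ξ) * p (inner A η η) := by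
    have hc : Tendsto (fun M : ℝ => M * p (inner A η η)) (𝓝[>] p (inner A ξ ξ))
        (𝓝 (p (inner A ξ ξ) * p (inner A η η))) :=
      tendsto_nhdsWithin_of_tendsto_nhds ((continuous_id.mul continuous_const).tendsto _)
    refine ge_of_tendsto hc ?_
    filter_upwards [self_mem_nhdsWithin] with M hM
    exact key M ((apply_nonneg p _).trans_lt hM) (le_of_lt hM)
  refine le_of_sq_le_sq ?_ (mul_nonneg (bar_nonneg p ξ) (bar_nonneg p η))
  rwa [mul_pow, bar_sq, bar_sq]

theorem bar_add_le (p : ContCStarSeminorm A) (ξ η : E) : bar p (ξ + η) ≤ bar p ξ + bar p η := by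
  refine le_of_sq_le_sq ?_ (add_nonneg (bar_nonneg p ξ) (bar_nonneg p η))
  rw [bar_sq, inner_add_right, inner_add_left, inner_add_left]
  have h1 := map_add_le_add p (inner A ξ ξ + inner A η ξ) (inner A ξ η + inner A η η)
  have h2 := map_add_le_add p (inner A ξ ξ) (inner A η ξ)
  have h3 := map_add_le_add p (inner A ξ η) (inner A η η)
  have h4 := apply_inner_le p ξ η
  have h5 := apply_inner_le p η ξ
  have h6 := bar_sq p ξ
  have h7 := bar_sq p η
  nlinarith

end StarModule

theorem bar_rmul_le (p : ContCStarSeminorm A) (ξ : E) (a : A) :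
    bar p (rmul ξ a) ≤ bar p ξ * p a := by
  refine le_of_sq_le_sq ?_ (mul_nonneg (bar_nonneg p ξ) (apply_nonneg p a))
  rw [bar_sq, inner_rmul_right, inner_rmul_left, mul_pow, bar_sq]
  have h1 := p.mul_le (star a * inner A ξ ξ) a
  have h2 := p.mul_le (star a) (inner A ξ ξ)
  rw [p.map_star] at h2
  nlinarith [apply_nonneg p a]

theorem bar_zero (p : ContCStarSeminorm A) : bar p (0 : E) = 0 := by
  rw [bar, inner_zero_right, map_zero, Real.sqrt_zero]

end HilbertModule

/-! ### Adjointable and compact operators -/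

namespace HilbertModule

section Operators

variable (A E : Type*) [NonUnitalRing A] [StarRing A] [Module ℂ A] [UniformSpace A]
  [AddCommGroup E] [Module ℂ E] [UniformSpace E] [HilbertModule A E]

variable {E} in
/-- `S` is an adjoint of `T`. -/
def AdjointPair (T S : Module.End ℂ E) : Prop :=
  ∀ ξ η : E, inner A (T ξ) η = inner A ξ (S η)

variable {E} in
/-- `T` commutes with the right action of `A`. -/
def RightLinear (T : Module.End ℂ E) : Prop :=
  ∀ (ξ : E) (a : A), T (rmul ξ a) = rmul (T ξ) a

variable {A} {E} in
theorem AdjointPair.symm {T S : Module.End ℂ E} (h : AdjointPair A T S) : AdjointPair A S T :=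
  fun ξ η => by rw [← star_inner, ← h, star_inner]

variable [IsLocallyCStarAlgebra A]

/-- `L(E)`, the algebra of adjointable module morphisms from `E` to `E`. -/
def Adjointable : Subalgebra ℂ (Module.End ℂ E) where
  carrier := {T | RightLinear A T ∧ ∃ S, RightLinear A S ∧ AdjointPair A T S}
  mul_mem' := by
    rintro T T' ⟨hT, S, hS, hTS⟩ ⟨hT', S', hS', hTS'⟩
    refine ⟨fun ξ a => ?_, S' * S, fun ξ a => ?_, fun ξ η => ?_⟩
    · simp only [Module.End.mul_apply, hT' ξ a, hT _ a]
    · simp only [Module.End.mul_apply, hS ξ a, hS' _ a]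
    · simp only [Module.End.mul_apply, hTS _ η, hTS' ξ _]
  add_mem' := by
    rintro T T' ⟨hT, S, hS, hTS⟩ ⟨hT', S', hS', hTS'⟩
    refine ⟨fun ξ a => ?_, S + S', fun ξ a => ?_, fun ξ η => ?_⟩
    · simp only [LinearMap.add_apply, hT ξ a, hT' ξ a, add_rmul]
    · simp only [LinearMap.add_apply, hS ξ a, hS' ξ a, add_rmul]
    · simp only [LinearMap.add_apply, inner_add_left, inner_add_right, hTS ξ η, hTS' ξ η]
  algebraMap_mem' c := by
    refine ⟨fun ξ a => ?_, algebraMap ℂ _ (star c), fun ξ a => ?_, fun ξ η => ?_⟩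
    · simp only [Module.algebraMap_end_apply, smul_rmul]
    · simp only [Module.algebraMap_end_apply, smul_rmul]
    · simp only [Module.algebraMap_end_apply, inner_smul_left, inner_smul_right]

variable {A E}

instance : FunLike (Adjointable A E) E E where
  coe T := T.1
  coe_injective _ _ h := Subtype.ext (DFunLike.coe_injective h)

namespace Adjointable

@[ext]
theorem ext {T S : Adjointable A E} (h : ∀ ξ, T ξ = S ξ) : T = S := DFunLike.ext _ _ h

theorem add_apply (T S : Adjointable A E) (ξ : E) : (T + S) ξ = T ξ + S ξ := rfl
theorem sub_apply (T S : Adjointable A E) (ξ : E) : (T - S) ξ = T ξ - S ξ := rfl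
theorem neg_apply (T : Adjointable A E) (ξ : E) : (-T) ξ = -T ξ := rfl
theorem zero_apply (ξ : E) : (0 : Adjointable A E) ξ = 0 := rfl
theorem smul_apply (c : ℂ) (T : Adjointable A E) (ξ : E) : (c • T) ξ = c • T ξ := rfl
theorem mul_apply (T S : Adjointable A E) (ξ : E) : (T * S) ξ = T (S ξ) := rfl
theorem map_sub (T : Adjointable A E) (ξ η : E) : T (ξ - η) = T ξ - T η :=
  LinearMap.map_sub T.1 ξ η
theorem map_rmul (T : Adjointable A E) (ξ : E) (a : A) : T (rmul ξ a) = rmul (T ξ) a :=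
  T.2.1 ξ a

/-- The adjoint of an adjointable operator. -/
instance : Star (Adjointable A E) where
  star T := ⟨T.2.2.choose, T.2.2.choose_spec.1, T.1, T.2.1, T.2.2.choose_spec.2.symm⟩

theorem inner_apply_left (T : Adjointable A E) (ξ η : E) :
    inner A (T ξ) η = inner A ξ (star T η) := T.2.2.choose_spec.2 ξ η

theorem inner_apply_right (T : Adjointable A E) (ξ η : E) :
    inner A ξ (T η) = inner A (star T ξ) η := by
  rw [← star_inner, inner_apply_left, star_inner]

instance : StarRing (Adjointable A E) where
  star_involutive T := by
    ext η
    refine ext_inner_left A fun ζ => ?_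
    rw [← inner_apply_left, ← inner_apply_right]
  star_mul T S := by
    ext η
    refine ext_inner_left A fun ζ => ?_
    simp only [← inner_apply_left, mul_apply]
  star_add T S := by
    ext η
    refine ext_inner_left A fun ζ => ?_
    simp only [← inner_apply_left, add_apply, inner_add_left, inner_add_right]

instance : StarModule ℂ (Adjointable A E) where
  star_smul c T := by
    ext η
    refine ext_inner_left A fun ζ => ?_
    simp only [← inner_apply_left, smul_apply, inner_smul_left, inner_smul_right]

/-- The set of operators whose operator norm with respect to each of the finitely many seminorms
`bar p`, `p ∈ F`, is at most `ε`. -/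
def ball (F : Finset (ContCStarSeminorm A)) (ε : ℝ) : Set (Adjointable A E) :=
  {T | ∀ p ∈ F, ∀ ξ, bar p (T ξ) ≤ ε * bar p ξ}

open Classical in
/-- The neighbourhoods of `0` for the topology of `L(E)`, which is the one given by the operator
seminorms `T ↦ sup {bar p (T ξ) | bar p ξ ≤ 1}`, `p` a continuous C⋆-seminorm on `A`. -/
@[reducible]
def filterBasis : AddGroupFilterBasis (Adjointable A E) :=
  addGroupFilterBasisOfComm {U | ∃ F ε, 0 < ε ∧ U = ball F ε}
    ⟨_, ∅, 1, one_pos, rfl⟩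
    (by
      rintro _ _ ⟨F, ε, hε, rfl⟩ ⟨F', ε', hε', rfl⟩
      refine ⟨ball (F ∪ F') (min ε ε'), ⟨_, _, lt_min hε hε', rfl⟩, fun T hT => ⟨?_, ?_⟩⟩
      · exact fun p hp ξ => (hT p (Finset.mem_union_left _ hp) ξ).trans
          (mul_le_mul_of_nonneg_right (min_le_left _ _) (bar_nonneg p ξ))
      · exact fun p hp ξ => (hT p (Finset.mem_union_right _ hp) ξ).trans
          (mul_le_mul_of_nonneg_right (min_le_right _ _) (bar_nonneg p ξ)))
    (by
      rintro _ ⟨F, ε, hε, rfl⟩ p hp ξ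
      rw [zero_apply, bar_zero]
      exact mul_nonneg hε.le (bar_nonneg p ξ))
    (by
      rintro _ ⟨F, ε, hε, rfl⟩
      refine ⟨ball F (ε / 2), ⟨_, _, half_pos hε, rfl⟩, ?_⟩
      rintro _ ⟨T, hT, S, hS, rfl⟩ p hp ξ
      have h1 := bar_add_le p (T ξ) (S ξ)
      have h2 := hT p hp ξ
      have h3 := hS p hp ξ
      change bar p (T ξ + S ξ) ≤ _
      linarith)
    (by
      rintro _ ⟨F, ε, hε, rfl⟩
      refine ⟨ball F ε, ⟨_, _, hε, rfl⟩, fun T hT p hp ξ => ?_⟩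
      rw [neg_apply, bar_neg]
      exact hT p hp ξ)

instance : TopologicalSpace (Adjointable A E) := filterBasis.topology

instance : IsTopologicalAddGroup (Adjointable A E) := filterBasis.isTopologicalAddGroup

theorem mem_closure_iff {s : Set (Adjointable A E)} {T : Adjointable A E} :
    T ∈ closure s ↔ ∀ F ε, 0 < ε → ∃ S ∈ s, S - T ∈ ball F ε := by
  rw [mem_closure_iff_nhds_basis (filterBasis.nhds_hasBasis T)]
  constructor
  · rintro h F ε hε
    obtain ⟨S, hS, V, hV, rfl⟩ := h (ball F ε) ⟨F, ε, hε, rfl⟩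
    exact ⟨_, hS, by simpa using hV⟩
  · rintro h _ ⟨F, ε, hε, rfl⟩
    obtain ⟨S, hS, hV⟩ := h F ε hε
    exact ⟨S, hS, S - T, hV, by simp⟩

/-- The rank one operator `θ_{ξ,η} : ζ ↦ ξ⟨η, ζ⟩`. -/
def rankOne (ξ η : E) : Adjointable A E :=
  ⟨{ toFun := fun ζ => rmul ξ (inner A η ζ)
     map_add' := fun ζ ω => by rw [inner_add_right, rmul_add]
     map_smul' := fun c ζ => by rw [inner_smul_right, rmul_smul]; rfl },
    fun ζ a => by
      simp only [LinearMap.coe_mk, AddHom.coe_mk, inner_rmul_right, rmul_mul],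
    { toFun := fun ζ => rmul η (inner A ξ ζ)
      map_add' := fun ζ ω => by rw [inner_add_right, rmul_add]
      map_smul' := fun c ζ => by rw [inner_smul_right, rmul_smul]; rfl },
    fun ζ a => by
      simp only [LinearMap.coe_mk, AddHom.coe_mk, inner_rmul_right, rmul_mul],
    fun ζ ω => by
      simp only [LinearMap.coe_mk, AddHom.coe_mk, inner_rmul_right, inner_rmul_left, star_inner]⟩

theorem rankOne_apply (ξ η ζ : E) : (rankOne ξ η : Adjointable A E) ζ = rmul ξ (inner A η ζ) := rfl

theorem star_rankOne (ξ η : E) : star (rankOne ξ η : Adjointable A E) = rankOne η ξ := by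
  ext ζ
  refine ext_inner_left A fun ω => ?_
  rw [← inner_apply_left, rankOne_apply, rankOne_apply, inner_rmul_left, inner_rmul_right,
    star_inner]

theorem mul_rankOne (T : Adjointable A E) (ξ η : E) : T * rankOne ξ η = rankOne (T ξ) η := by
  ext ζ
  rw [mul_apply, rankOne_apply, rankOne_apply, map_rmul]

variable (A E) in
/-- `Θ(E)`, the linear span of the rank one operators. -/
def finiteRank : Submodule ℂ (Adjointable A E) :=
  Submodule.span ℂ (Set.range fun x : E × E => rankOne x.1 x.2)

theorem mul_mem_finiteRank (T : Adjointable A E) {S : Adjointable A E}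
    (hS : S ∈ finiteRank A E) : T * S ∈ finiteRank A E := by
  induction hS using Submodule.span_induction with
  | mem S hS =>
    obtain ⟨x, rfl⟩ := hS
    exact Submodule.subset_span ⟨(T x.1, x.2), (mul_rankOne T x.1 x.2).symm⟩
  | zero => rw [mul_zero]; exact zero_mem _
  | add S S' _ _ h h' => rw [mul_add]; exact add_mem h h'
  | smul c S _ h => rw [mul_smul_comm]; exact Submodule.smul_mem _ c h

theorem star_mem_finiteRank {S : Adjointable A E}
    (hS : S ∈ finiteRank A E) : star S ∈ finiteRank A E := by
  induction hS using Submodule.span_induction with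
  | mem S hS =>
    obtain ⟨x, rfl⟩ := hS
    exact Submodule.subset_span ⟨(x.2, x.1), (star_rankOne x.1 x.2).symm⟩
  | zero => rw [star_zero]; exact zero_mem _
  | add S S' _ _ h h' => rw [star_add]; exact add_mem h h'
  | smul c S _ h => rw [star_smul]; exact Submodule.smul_mem _ _ h

theorem exists_bound_of_mem_finiteRank (p : ContCStarSeminorm A) {S : Adjointable A E}
    (hS : S ∈ finiteRank A E) : ∃ M, 0 ≤ M ∧ ∀ ξ, bar p (S ξ) ≤ M * bar p ξ := by
  induction hS using Submodule.span_induction with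
  | mem S hS =>
    obtain ⟨⟨ξ, η⟩, rfl⟩ := hS
    refine ⟨bar p ξ * bar p η, mul_nonneg (bar_nonneg p ξ) (bar_nonneg p η), fun ζ => ?_⟩
    rw [rankOne_apply, mul_assoc]
    exact (bar_rmul_le p ξ _).trans
      (mul_le_mul_of_nonneg_left (apply_inner_le p η ζ) (bar_nonneg p ξ))
  | zero => exact ⟨0, le_rfl, fun ξ => by rw [zero_apply, bar_zero, zero_mul]⟩
  | add S S' _ _ h h' =>
    obtain ⟨M, hM, h⟩ := h
    obtain ⟨M', hM', h'⟩ := h'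
    refine ⟨M + M', add_nonneg hM hM', fun ξ => (bar_add_le p (S ξ) (S' ξ)).trans ?_⟩
    rw [add_mul]
    exact add_le_add (h ξ) (h' ξ)
  | smul c S _ h =>
    obtain ⟨M, hM, h⟩ := h
    refine ⟨‖c‖ * M, mul_nonneg (norm_nonneg c) hM, fun ξ => ?_⟩
    rw [smul_apply, bar_smul, mul_assoc]
    exact mul_le_mul_of_nonneg_left (h ξ) (norm_nonneg c)

theorem exists_bound_of_mem_closure (p : ContCStarSeminorm A) {T : Adjointable A E}
    (hT : T ∈ closure (finiteRank A E : Set (Adjointable A E))) :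
    ∃ M, 0 ≤ M ∧ ∀ ξ, bar p (T ξ) ≤ M * bar p ξ := by
  obtain ⟨S, hS, hST⟩ := mem_closure_iff.1 hT {p} 1 one_pos
  obtain ⟨M, hM, h⟩ := exists_bound_of_mem_finiteRank p hS
  refine ⟨M + 1, by linarith, fun ξ => ?_⟩
  have h1 := hST p (Finset.mem_singleton_self p) ξ
  have h2 := bar_add_le p (S ξ) (-((S - T) ξ))
  rw [bar_neg] at h2
  have h3 : S ξ + -((S - T) ξ) = T ξ := by rw [sub_apply]; abel
  rw [h3] at h2
  have h4 := h ξ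
  linarith

theorem star_mem_ball {F : Finset (ContCStarSeminorm A)} {ε : ℝ} (hε : 0 ≤ ε)
    {T : Adjointable A E} (hT : T ∈ ball F ε) : star T ∈ ball F ε := by
  intro p hp ξ
  have h1 : bar p (star T ξ) ^ 2 ≤ bar p (T (star T ξ)) * bar p ξ := by
    rw [bar_sq, ← inner_apply_left]
    exact apply_inner_le p _ _
  have h2 := hT p hp (star T ξ)
  rcases (bar_nonneg p (star T ξ)).eq_or_lt with h0 | h0
  · rw [← h0]
    exact mul_nonneg hε (bar_nonneg p ξ)
  · have h3 := mul_le_mul_of_nonneg_right h2 (bar_nonneg p ξ)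
    nlinarith

end Adjointable

open Adjointable

variable (A E) in
/-- `K(E)`, the closure in `L(E)` of the linear span of the rank one operators, as a ⋆-algebra
with the topology of `L(E)`. -/
def Compact : NonUnitalStarSubalgebra ℂ (Adjointable A E) where
  carrier := closure (finiteRank A E : Set (Adjointable A E))
  zero_mem' := subset_closure (zero_mem (finiteRank A E))
  add_mem' hT hS := (finiteRank A E).toAddSubgroup.topologicalClosure.add_mem hT hS
  smul_mem' c T hT := by
    rw [Adjointable.mem_closure_iff] at hT ⊢
    intro F ε hε
    obtain ⟨S, hS, h⟩ := hT F (ε / (‖c‖ + 1)) (by positivity)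
    refine ⟨c • S, Submodule.smul_mem _ c hS, fun p hp ξ => ?_⟩
    rw [← smul_sub, Adjointable.smul_apply, bar_smul]
    refine (mul_le_mul_of_nonneg_left (h p hp ξ) (norm_nonneg c)).trans ?_
    rw [← mul_assoc]
    refine mul_le_mul_of_nonneg_right ?_ (bar_nonneg p ξ)
    rw [mul_div_assoc', div_le_iff₀ (by positivity)]
    nlinarith [norm_nonneg c]
  mul_mem' {T S} hT hS := by
    choose M hM0 hM using fun p => exists_bound_of_mem_closure p hT
    rw [Adjointable.mem_closure_iff] at hS ⊢
    intro F ε hε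
    have hN : 0 ≤ ∑ p ∈ F, M p := Finset.sum_nonneg fun p _ => hM0 p
    obtain ⟨S', hS', h⟩ := hS F (ε / (∑ p ∈ F, M p + 1)) (by positivity)
    refine ⟨T * S', mul_mem_finiteRank T hS', fun p hp ξ => ?_⟩
    rw [← mul_sub, mul_apply]
    refine (hM p _).trans ((mul_le_mul_of_nonneg_left (h p hp ξ) (hM0 p)).trans ?_)
    rw [← mul_assoc]
    refine mul_le_mul_of_nonneg_right ?_ (bar_nonneg p ξ)
    rw [mul_div_assoc', div_le_iff₀ (by positivity)]
    nlinarith [Finset.single_le_sum (fun p _ => hM0 p) hp]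
  star_mem' {T} hT := by
    rw [Adjointable.mem_closure_iff] at hT ⊢
    intro F ε hε
    obtain ⟨S, hS, h⟩ := hT F ε hε
    have h' := star_mem_ball hε.le h
    rw [star_sub] at h'
    exact ⟨star S, star_mem_finiteRank hS, h'⟩

/-- The rank one operator `θ_{ξ,η}` as an element of `K(E)`. -/
def theta (A : Type*) {E : Type*} [NonUnitalRing A] [StarRing A] [Module ℂ A] [UniformSpace A]
    [AddCommGroup E] [Module ℂ E] [UniformSpace E] [HilbertModule A E] [IsLocallyCStarAlgebra A]
    (ξ η : E) : Compact A E :=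
  ⟨rankOne ξ η, subset_closure (Submodule.subset_span ⟨(ξ, η), rfl⟩)⟩

end Operators

end HilbertModule

/-! ### Group actions on locally C⋆-algebras -/

/-- `Aut(A)`: the ⋆-automorphisms of `A` that are continuous together with their inverses. -/
def ContStarAut (A : Type*) [NonUnitalRing A] [StarRing A] [Module ℂ A] [TopologicalSpace A] :
    Subgroup (A ≃⋆ₐ[ℂ] A) where
  carrier := {φ | Continuous φ ∧ Continuous φ.symm}
  one_mem' := ⟨continuous_id, continuous_id⟩
  mul_mem' h h' := ⟨h.1.comp h'.1, h'.2.comp h.2⟩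
  inv_mem' h := ⟨h.2, h.1⟩

/-- An inverse system of C⋆-algebras over a preordered set. -/
structure CStarSystem (Λ : Type w) [Preorder Λ] where
  alg : Λ → Type v
  [cstar : ∀ i, NonUnitalCStarAlgebra (alg i)]
  map : ∀ {i j : Λ}, j ≤ i → (alg i →⋆ₙₐ[ℂ] alg j)
  map_self : ∀ (i : Λ) (x : alg i), map (le_refl i) x = x
  map_map : ∀ {i j k : Λ} (hij : j ≤ i) (hjk : k ≤ j) (x : alg i),
    map hjk (map hij x) = map (hjk.trans hij) x

attribute [instance] CStarSystem.cstar

/-- An identification of the topological ⋆-algebra `A` with the inverse limit of an inverse system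
of C⋆-algebras, i.e. with the ⋆-algebra of coherent families with the product topology; it is
given by its components `proj i`. -/
structure CStarSystem.Limit {Λ : Type*} [Preorder Λ] (S : CStarSystem Λ) (A : Type*)
    [NonUnitalRing A] [StarRing A] [Module ℂ A] [TopologicalSpace A] where
  proj : ∀ i, A →⋆ₙₐ[ℂ] S.alg i
  map_proj : ∀ {i j : Λ} (h : j ≤ i) (a : A), S.map h (proj i a) = proj j a
  existsUnique : ∀ x : ∀ i, S.alg i, (∀ {i j : Λ} (h : j ≤ i), S.map h (x i) = x j) →
    ∃! a : A, ∀ i, proj i a = x i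
  isInducing : IsInducing fun (a : A) (i : Λ) => proj i a

namespace ContStarAut

variable {G : Type*} [Group G]

section

universe u

variable {A : Type u} [NonUnitalRing A] [StarRing A] [Module ℂ A] [TopologicalSpace A]

/-- The action `α` of `G` on `A` is continuous. -/
def IsContinuousAction [TopologicalSpace G] (α : G →* ContStarAut A) : Prop :=
  ∀ a : A, Continuous fun g => (α g).1 a

/-- The action `α` is an inverse limit action: `A` is the limit of an inverse system (over a
directed set) of C⋆-algebras `A_i`, and `α` is the limit of an inverse system of actions of `G` on
the `A_i`. -/
def IsInverseLimitAction (α : G →* ContStarAut A) : Prop :=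
  ∃ (Λ : Type u) (_ : Preorder Λ) (_ : IsDirectedOrder Λ) (_ : Nonempty Λ)
    (S : CStarSystem.{u, u} Λ) (P : S.Limit A) (α' : ∀ i, G →* ContStarAut (S.alg i)),
    (∀ (g : G) (i j : Λ) (h : j ≤ i) (x : S.alg i),
      S.map h ((α' i g).1 x) = (α' j g).1 (S.map h x)) ∧
    ∀ (g : G) (i : Λ) (a : A), P.proj i ((α g).1 a) = (α' i g).1 (P.proj i a)

/-- The `G`-invariant continuous C⋆-seminorms are cofinal among all continuous C⋆-seminorms. -/
def HasCofinalInvariantSeminorms (α : G →* ContStarAut A) : Prop :=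
  ∀ q : ContCStarSeminorm A, ∃ p : ContCStarSeminorm A,
    (∀ (g : G) (a : A), p ((α g).1 a) = p a) ∧ ∀ a : A, q a ≤ p a

/-- A continuous inverse limit action: a continuous action that is an inverse limit action and has
a cofinal set of invariant continuous C⋆-seminorms. -/
def IsContinuousInverseLimitAction [TopologicalSpace G] (α : G →* ContStarAut A) : Prop :=
  IsContinuousAction α ∧ IsInverseLimitAction α ∧ HasCofinalInvariantSeminorms α

end

end ContStarAut

/-! ### Group actions on Hilbert modules -/

/-- A map `u : E → F` is a morphism of Hilbert modules if there is a morphism `α : A → B` of locally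
C⋆-algebras with `⟨u ξ, u η⟩ = α ⟨ξ, η⟩`. -/
def IsHilbertModuleMorphism (A B : Type*) {E F : Type*}
    [NonUnitalRing A] [StarRing A] [Module ℂ A] [UniformSpace A]
    [AddCommGroup E] [Module ℂ E] [UniformSpace E] [HilbertModule A E]
    [NonUnitalRing B] [StarRing B] [Module ℂ B] [UniformSpace B]
    [AddCommGroup F] [Module ℂ F] [UniformSpace F] [HilbertModule B F] (u : E → F) : Prop :=
  ∃ α : A →⋆ₙₐ[ℂ] B, Continuous α ∧ ∀ ξ η : E, inner B (u ξ) (u η) = α (inner A ξ η)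

/-- `Aut(E)`: the bijections `u` of `E` such that `u` and its inverse are morphisms of Hilbert
modules. -/
def HilbertAut (A E : Type*) [NonUnitalRing A] [StarRing A] [Module ℂ A] [UniformSpace A]
    [AddCommGroup E] [Module ℂ E] [UniformSpace E] [HilbertModule A E] :
    Subgroup (Equiv.Perm E) where
  carrier := {u | IsHilbertModuleMorphism A A u ∧ IsHilbertModuleMorphism A A u.symm}
  one_mem' := ⟨⟨NonUnitalStarAlgHom.id ℂ A, continuous_id, fun _ _ => rfl⟩,
    ⟨NonUnitalStarAlgHom.id ℂ A, continuous_id, fun _ _ => rfl⟩⟩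
  mul_mem' := by
    rintro u v ⟨⟨α, hα, hu⟩, α', hα', hu'⟩ ⟨⟨β, hβ, hv⟩, β', hβ', hv'⟩
    refine ⟨⟨α.comp β, hα.comp hβ, fun ξ η => ?_⟩, β'.comp α', hβ'.comp hα', fun ξ η => ?_⟩
    · exact (hu _ _).trans (congrArg α (hv _ _))
    · exact (hv' _ _).trans (congrArg β' (hu' _ _))
  inv_mem' h := ⟨h.2, h.1⟩

/-- An inverse system of Hilbert C⋆-modules over an inverse system of C⋆-algebras. -/
structure HilbertSystem (Λ : Type w) [Preorder Λ] extends CStarSystem.{w, v} Λ where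
  mod : Λ → Type x
  [addCommGroup : ∀ i, AddCommGroup (mod i)]
  [module : ∀ i, Module ℂ (mod i)]
  [uniformSpace : ∀ i, UniformSpace (mod i)]
  [hilbertModule : ∀ i, HilbertModule (alg i) (mod i)]
  mmap : ∀ {i j : Λ}, j ≤ i → (mod i →ₗ[ℂ] mod j)
  mmap_rmul : ∀ {i j : Λ} (h : j ≤ i) (ξ : mod i) (a : alg i),
    mmap h (HilbertModule.rmul ξ a) = HilbertModule.rmul (mmap h ξ) (map h a)
  inner_mmap : ∀ {i j : Λ} (h : j ≤ i) (ξ η : mod i),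
    inner (alg j) (mmap h ξ) (mmap h η) = map h (inner (alg i) ξ η)
  mmap_self : ∀ (i : Λ) (ξ : mod i), mmap (le_refl i) ξ = ξ
  mmap_mmap : ∀ {i j k : Λ} (hij : j ≤ i) (hjk : k ≤ j) (ξ : mod i),
    mmap hjk (mmap hij ξ) = mmap (hjk.trans hij) ξ

attribute [instance] HilbertSystem.addCommGroup HilbertSystem.module HilbertSystem.uniformSpace
  HilbertSystem.hilbertModule

/-- An identification of the Hilbert `A`-module `E` with the inverse limit of an inverse system of
Hilbert C⋆-modules: `A` is identified with the limit of the C⋆-algebras, and `E` with the module of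
coherent families, compatibly with the linear structure, the module action and the inner products.
(The topologies then correspond to each other automatically.) -/
structure HilbertSystem.Limit {Λ : Type*} [Preorder Λ] (S : HilbertSystem Λ) (A E : Type*)
    [NonUnitalRing A] [StarRing A] [Module ℂ A] [UniformSpace A]
    [AddCommGroup E] [Module ℂ E] [UniformSpace E] [HilbertModule A E] where
  algLimit : S.toCStarSystem.Limit A
  mproj : ∀ i, E →ₗ[ℂ] S.mod i
  mproj_rmul : ∀ (i : Λ) (ξ : E) (a : A),
    mproj i (HilbertModule.rmul ξ a) = HilbertModule.rmul (mproj i ξ) (algLimit.proj i a)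
  inner_mproj : ∀ (i : Λ) (ξ η : E),
    inner (S.alg i) (mproj i ξ) (mproj i η) = algLimit.proj i (inner A ξ η)
  mmap_mproj : ∀ {i j : Λ} (h : j ≤ i) (ξ : E), S.mmap h (mproj i ξ) = mproj j ξ
  existsUnique : ∀ x : ∀ i, S.mod i, (∀ {i j : Λ} (h : j ≤ i), S.mmap h (x i) = x j) →
    ∃! ξ : E, ∀ i, mproj i ξ = x i

namespace HilbertAut

variable {G : Type*} [Group G] {A E : Type*}
  [NonUnitalRing A] [StarRing A] [Module ℂ A] [UniformSpace A]
  [AddCommGroup E] [Module ℂ E] [UniformSpace E] [HilbertModule A E]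

/-- The action `u` of `G` on `E` is continuous. -/
def IsContinuousAction [TopologicalSpace G] (u : G →* HilbertAut A E) : Prop :=
  ∀ ξ : E, Continuous fun g => (u g).1 ξ

/-- The action `u` is an inverse limit action: `E` is the limit of an inverse system (over a
directed set) of Hilbert C⋆-modules `E_i`, and `u` is the limit of an inverse system of actions of
`G` on the `E_i`. -/
def IsInverseLimitAction (u : G →* HilbertAut A E) : Prop :=
  ∃ (Λ : Type w) (_ : Preorder Λ) (_ : IsDirectedOrder Λ) (_ : Nonempty Λ)
    (S : HilbertSystem.{w, v, x} Λ) (P : S.Limit A E)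
    (u' : ∀ i, G →* HilbertAut (S.alg i) (S.mod i)),
    (∀ (g : G) (i j : Λ) (h : j ≤ i) (ξ : S.mod i),
      S.mmap h ((u' i g).1 ξ) = (u' j g).1 (S.mmap h ξ)) ∧
    ∀ (g : G) (i : Λ) (ξ : E), P.mproj i ((u g).1 ξ) = (u' i g).1 (P.mproj i ξ)

/-- A continuous inverse limit action of `G` on `E`. -/
def IsContinuousInverseLimitAction [TopologicalSpace G] (u : G →* HilbertAut A E) :
    Prop :=
  IsContinuousAction u ∧ IsInverseLimitAction.{w, v, x} u

end HilbertAut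

end

/-!
Since `E` is full, an automorphism `u` of `E` determines a ⋆-endomorphism of `A` on the dense span
of the inner products, and these endomorphisms compose as the automorphisms do; on `K(E)` the action
is conjugation `T ↦ u T u⁻¹`.

For an inverse limit action, each seminorm `a ↦ ‖a_λ‖` on `A` is decreased by every `α_g`, because
⋆-homomorphisms of C⋆-algebras are contractive, and hence is invariant, because `G` is a group. So
the invariant seminorms are cofinal in `S(A)`. They are cofinal in `S(K(E))` as well: `p̃` is
invariant if `p` is, and `p̃` is increasing in `p`. The latter rests on a spectral radius argument:
for self-adjoint `T` and a seminorm `q ≤ p`, the bound `p̃ (T ^ n) ≤ p̃ (T) ^ n` controls the growth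
of the powers of `T` also with respect to `q`, and this growth determines `q̃ (T)`.

Cofinal invariant seminorms make an action equicontinuous, so that its continuity can be checked on
generators, and the completions with respect to these seminorms exhibit it as an inverse limit
action.
-/

noncomputable section

/-! ### Cofinal families of C⋆-seminorms and the Arens–Michael decomposition -/

theorem ext_of_dense_span {R M N F : Type*} [Semiring R] [AddCommMonoid M] [Module R M]
    [TopologicalSpace M] [AddCommMonoid N] [Module R N] [TopologicalSpace N] [T2Space N]
    [FunLike F M N] [LinearMapClass F R M N] {f g : F} (hf : Continuous f) (hg : Continuous g)
    {s : Set M} (hs : Dense (Submodule.span R s : Set M)) (h : Set.EqOn f g s) : f = g :=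
  DFunLike.coe_injective <| hf.ext_on hs hg <|
    LinearMap.eqOn_span (f := (f : M →ₗ[R] N)) (g := (g : M →ₗ[R] N)) h

theorem le_of_forall_pow_le_const_mul_pow {x y C : ℝ} (hy : 0 ≤ y) {k : ℕ → ℕ}
    (hk : Tendsto k atTop atTop) (h : ∀ n, x ^ k n ≤ C * y ^ k n) : x ≤ y := by
  by_contra! hyx
  have hx : 0 < x := hy.trans_lt hyx
  have hlim : Tendsto (fun n => C * (y / x) ^ k n) atTop (𝓝 0) := by
    simpa using ((tendsto_pow_atTop_nhds_zero_of_lt_one (by positivity)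
      ((div_lt_one hx).2 hyx)).comp hk).const_mul C
  refine (ge_of_tendsto' hlim fun n => ?_ : (1 : ℝ) ≤ 0).not_gt one_pos
  rw [div_pow, ← mul_div_assoc, one_le_div (by positivity)]
  exact h n

namespace ContCStarSeminorm

section Order

variable {A B : Type*} [NonUnitalRing A] [StarRing A] [Module ℂ A] [TopologicalSpace A]
  [NonUnitalRing B] [StarRing B] [Module ℂ B] [TopologicalSpace B]

theorem continuous (p : ContCStarSeminorm A) : Continuous p := p.continuous'

theorem tendsto_zero (p : ContCStarSeminorm A) : Tendsto p (𝓝 0) (𝓝 0) :=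
  map_zero p ▸ p.continuous.tendsto 0

instance : PartialOrder (ContCStarSeminorm A) :=
  PartialOrder.lift (fun p => (p : A → ℝ)) DFunLike.coe_injective

instance : SemilatticeSup (ContCStarSeminorm A) where
  sup p q :=
    { toSeminorm := p.toSeminorm ⊔ q.toSeminorm
      mul_le' := fun a b => max_le
        ((p.mul_le a b).trans <| mul_le_mul (le_max_left _ _) (le_max_left _ _) (apply_nonneg p b)
          ((apply_nonneg p a).trans (le_max_left _ _)))
        ((q.mul_le a b).trans <| mul_le_mul (le_max_right _ _) (le_max_right _ _)
          (apply_nonneg q b) ((apply_nonneg q a).trans (le_max_right _ _)))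
      star_mul_self' := fun a => by
        change max (p (star a * a)) (q (star a * a)) = max (p a) (q a) ^ 2
        rw [p.star_mul_self, q.star_mul_self]
        exact ((pow_left_monotoneOn (n := 2)).map_max (apply_nonneg p a) (apply_nonneg q a)).symm
      continuous' := p.continuous.max q.continuous }
  le_sup_left _ _ _ := le_max_left _ _
  le_sup_right _ _ _ := le_max_right _ _
  sup_le _ _ _ h h' a := max_le (h a) (h' a)

theorem sup_apply (p q : ContCStarSeminorm A) (a : A) : (p ⊔ q) a = max (p a) (q a) := rfl

instance : OrderBot (ContCStarSeminorm A) where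
  bot :=
    { toSeminorm := 0
      mul_le' := fun _ _ => (mul_zero (0 : ℝ)).ge
      star_mul_self' := fun _ => (zero_pow two_ne_zero).symm
      continuous' := continuous_const }
  bot_le p a := apply_nonneg p a

/-- The pullback of a continuous C⋆-seminorm along a continuous ⋆-homomorphism. -/
def comp (p : ContCStarSeminorm B) (φ : A →⋆ₙₐ[ℂ] B) (hφ : Continuous φ) :
    ContCStarSeminorm A where
  toSeminorm := p.toSeminorm.comp (φ : A →ₗ[ℂ] B)
  mul_le' a b := (congrArg p (map_mul φ a b)).trans_le (p.mul_le _ _)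
  star_mul_self' a :=
    (congrArg p ((map_mul φ _ a).trans (congrArg (· * φ a) (StarHomClass.map_star φ a)))).trans
      (p.star_mul_self _)
  continuous' := p.continuous.comp hφ

/-- The norm of a C⋆-algebra, as a continuous C⋆-seminorm. -/
def ofNorm (B : Type*) [NonUnitalCStarAlgebra B] : ContCStarSeminorm B where
  toSeminorm := normSeminorm ℂ B
  mul_le' := norm_mul_le
  star_mul_self' a := CStarRing.norm_star_mul_self.trans (sq ‖a‖).symm
  continuous' := continuous_norm

theorem pow_two_pow_le_of_isSelfAdjoint {p q : ContCStarSeminorm A} {C : ℝ}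
    (h : ∀ a, q a ≤ C * p a) (n : ℕ) {a : A} (ha : IsSelfAdjoint a) :
    q a ^ 2 ^ n ≤ C * p a ^ 2 ^ n := by
  have apply_mul_self (r : ContCStarSeminorm A) {b : A} (hb : IsSelfAdjoint b) :
      r (b * b) = r b ^ 2 := by simpa only [hb.star_eq] using r.star_mul_self b
  induction n generalizing a with
  | zero => simpa using h a
  | succ n ih =>
    simpa only [apply_mul_self _ ha, ← pow_mul, ← pow_succ'] using
      ih ((ha.commute_iff ha).1 (.refl a))

theorem le_of_le_const_mul {p q : ContCStarSeminorm A} {C : ℝ} (h : ∀ a, q a ≤ C * p a) :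
    q ≤ p := by
  intro a
  refine le_of_sq_le_sq ?_ (apply_nonneg p a)
  rw [← p.star_mul_self, ← q.star_mul_self]
  exact le_of_forall_pow_le_const_mul_pow (apply_nonneg p _)
    (tendsto_pow_atTop_atTop_of_one_lt one_lt_two)
    fun n => pow_two_pow_le_of_isSelfAdjoint h n (.star_mul_self a)

theorem le_of_forall_lt {p q : ContCStarSeminorm A} {ε : ℝ} (hε : 0 < ε)
    (h : ∀ a, p a < ε → q a < 1) : q ≤ p := by
  refine le_of_le_const_mul (C := ε⁻¹) fun a => ?_
  by_contra! hlt
  have hq : 0 < q a := (by positivity : 0 ≤ ε⁻¹ * p a).trans_lt hlt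
  have hnorm : ‖((q a)⁻¹ : ℂ)‖ = (q a)⁻¹ := by
    rw [norm_inv, Complex.norm_real, Real.norm_of_nonneg hq.le]
  have hp : p (((q a)⁻¹ : ℂ) • a) < ε := by
    rwa [map_smul_eq_mul, hnorm, inv_mul_lt_iff₀ hq, mul_comm, ← inv_mul_lt_iff₀ hε]
  refine (h _ hp).ne ?_
  rw [map_smul_eq_mul, hnorm, inv_mul_cancel₀ hq.ne']

end Order

section Completion

variable {A B D : Type*} [NonUnitalRing A] [StarRing A] [Module ℂ A] [TopologicalSpace A]
  [NonUnitalRing B] [StarRing B] [Module ℂ B] [TopologicalSpace B]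
  [NonUnitalRing D] [StarRing D] [Module ℂ D] [TopologicalSpace D]

theorem dist_toCompl (p : ContCStarSeminorm A) (a b : A) :
    dist (p.toCompl a) (p.toCompl b) = p (a - b) := by
  rw [dist_eq_norm, ← norm_toCompl]
  exact congrArg _ (UniformSpace.Completion.coe_sub (α := p.Pre) a b).symm

section

variable (p : ContCStarSeminorm A) (q : ContCStarSeminorm B) (φ : A →⋆ₙₐ[ℂ] B)

/-- The map of completions which extends a contractive ⋆-homomorphism `φ`; a junk value if `φ` is
not contractive. -/
def complFun : p.Compl → q.Compl :=
  UniformSpace.Completion.map (fun a : p.Pre => (show q.Pre from φ a))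

theorem continuous_complFun : Continuous (complFun p q φ) :=
  UniformSpace.Completion.continuous_map

variable {p q φ}

theorem complFun_toCompl (h : ∀ a, q (φ a) ≤ p a) (a : A) :
    complFun p q φ (p.toCompl a) = q.toCompl (φ a) :=
  UniformSpace.Completion.map_coe (α := p.Pre) (β := q.Pre)
    (AddMonoidHomClass.uniformContinuous_of_bound (E := p.Pre) (F := q.Pre)
      (⟨⟨fun a => φ a, map_zero φ⟩, map_add φ⟩ : p.Pre →+ q.Pre) 1
      fun a => by rw [one_mul]; exact h a) a

end

variable [IsScalarTower ℂ A A] [SMulCommClass ℂ A A] [StarModule ℂ A]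
  [IsScalarTower ℂ B B] [SMulCommClass ℂ B B] [StarModule ℂ B]
  [IsScalarTower ℂ D D] [SMulCommClass ℂ D D] [StarModule ℂ D]

/-- The canonical map of `A` into its completion with respect to `p`, as a ⋆-homomorphism. -/
def toComplHom (p : ContCStarSeminorm A) : A →⋆ₙₐ[ℂ] p.Compl where
  toFun := p.toCompl
  map_smul' := p.toCompl_smul
  map_zero' := p.toCompl_zero
  map_add' := p.toCompl_add
  map_mul' := p.toCompl_mul
  map_star' := p.toCompl_star

section ComplMap

variable (p : ContCStarSeminorm A) (q : ContCStarSeminorm B) (r : ContCStarSeminorm D)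
  (φ : A →⋆ₙₐ[ℂ] B) (ψ : B →⋆ₙₐ[ℂ] D)

/-- The ⋆-homomorphism of completions which extends a contractive ⋆-homomorphism. -/
def complMap (h : ∀ a, q (φ a) ≤ p a) : p.Compl →⋆ₙₐ[ℂ] q.Compl where
  toFun := complFun p q φ
  map_smul' c x := by
    have hc := continuous_complFun p q φ
    refine p.compl_induction x (isClosed_eq (hc.comp (p.compl_continuous_smul c))
      ((q.compl_continuous_smul c).comp hc)) fun a => ?_
    simp only [← toCompl_smul, complFun_toCompl h, map_smul, MonoidHom.id_apply]
  map_zero' := by rw [← toCompl_zero, complFun_toCompl h, map_zero φ, toCompl_zero]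
  map_add' x y := by
    have hc := continuous_complFun p q φ
    refine p.compl_induction₂ x y (isClosed_eq (by fun_prop) (by fun_prop)) fun a b => ?_
    simp only [← toCompl_add, complFun_toCompl h, map_add φ]
  map_mul' x y := by
    have hc := continuous_complFun p q φ
    refine p.compl_induction₂ x y (isClosed_eq (by fun_prop) (by fun_prop)) fun a b => ?_
    simp only [← toCompl_mul, complFun_toCompl h, map_mul φ]
  map_star' x := by
    have hc := continuous_complFun p q φ
    refine p.compl_induction x (isClosed_eq (by fun_prop) (by fun_prop)) fun a => ?_
    simp only [← toCompl_star, complFun_toCompl h, StarHomClass.map_star φ]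

variable {p q r φ ψ}

theorem complMap_toCompl (h : ∀ a, q (φ a) ≤ p a) (a : A) :
    complMap p q φ h (p.toCompl a) = q.toCompl (φ a) := complFun_toCompl h a

theorem continuous_complMap (h : ∀ a, q (φ a) ≤ p a) : Continuous (complMap p q φ h) :=
  continuous_complFun p q φ

theorem complMap_eq_self {φ : A →⋆ₙₐ[ℂ] A} (h : ∀ a, p (φ a) ≤ p a) (hφ : ∀ a, φ a = a)
    (x : p.Compl) : complMap p p φ h x = x :=
  p.compl_induction x (isClosed_eq (continuous_complMap _) continuous_id)
    fun a => (complMap_toCompl h a).trans (congrArg _ (hφ a))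

theorem complMap_complMap {χ : A →⋆ₙₐ[ℂ] D} (hφ : ∀ a, q (φ a) ≤ p a) (hψ : ∀ b, r (ψ b) ≤ q b)
    (hχ : ∀ a, r (χ a) ≤ p a) (h : ∀ a, ψ (φ a) = χ a) (x : p.Compl) :
    complMap q r ψ hψ (complMap p q φ hφ x) = complMap p r χ hχ x :=
  p.compl_induction x
    (isClosed_eq ((continuous_complMap _).comp (continuous_complMap _)) (continuous_complMap _))
    fun a => by simp only [complMap_toCompl, h]

end ComplMap

universe u

variable {Λ : Type u} [Preorder Λ]

/-- The inverse system of the completions of `A` with respect to an increasing family of continuous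
C⋆-seminorms. -/
def complSystem {p : Λ → ContCStarSeminorm A} (hp : Monotone p) : CStarSystem Λ where
  alg i := (p i).Compl
  map h := complMap _ _ (NonUnitalStarAlgHom.id ℂ A) (hp h)
  map_self _ x := complMap_eq_self _ (fun _ => rfl) x
  map_map _ _ x := complMap_complMap _ _ _ (fun _ => rfl) x

end Completion

end ContCStarSeminorm

namespace IsLocallyCStarAlgebra

variable {A : Type*} [NonUnitalRing A] [StarRing A] [Module ℂ A] [UniformSpace A]
  [IsLocallyCStarAlgebra A]

theorem nhds_zero_eq_iInf {ι : Sort*} {p : ι → ContCStarSeminorm A} (hp : ∀ q, ∃ i, q ≤ p i) :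
    𝓝 (0 : A) = ⨅ i, comap (p i) (𝓝 (0 : ℝ)) := by
  rw [nhds_zero]
  refine le_antisymm (le_iInf fun i => iInf_le _ (p i)) (le_iInf fun q => ?_)
  obtain ⟨i, hi⟩ := hp q
  exact (iInf_le _ i).trans <| tendsto_iff_comap.1 <|
    squeeze_zero (apply_nonneg q) hi tendsto_comap

theorem tendsto_iff {X : Type*} {l : Filter X} {f : X → A} {a : A} :
    Tendsto f l (𝓝 a) ↔ ∀ p : ContCStarSeminorm A, Tendsto (fun x => p (f x - a)) l (𝓝 0) := by
  rw [← nhds_translation_sub, tendsto_comap_iff, nhds_zero]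
  simp only [tendsto_iInf, tendsto_comap_iff]
  rfl

instance : ContinuousConstSMul ℂ A where
  continuous_const_smul c := continuous_iff_continuousAt.2 fun a => tendsto_iff.2 fun p => by
    simpa only [← smul_sub, map_smul_eq_mul, mul_zero, id] using
      (tendsto_iff.1 (continuous_id.tendsto a) p).const_mul ‖c‖

theorem isUniformInducing_toCompl {ι : Type*} {p : ι → ContCStarSeminorm A}
    (hp : ∀ q, ∃ i, q ≤ p i) : IsUniformInducing fun (a : A) i => (p i).toCompl a where
  comap_uniformity := by
    rw [uniformity_eq_comap_nhds_zero A, nhds_zero_eq_iInf hp, Pi.uniformity]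
    simp only [comap_iInf, comap_comap, Metric.uniformity_eq_comap_nhds_zero]
    refine iInf_congr fun i => congrArg (comap · _) (funext fun y => ?_)
    exact ((p i).dist_toCompl y.1 y.2).trans (map_sub_rev (p i) _ _)

theorem exists_toCompl_eq {Λ : Type*} [Preorder Λ] [IsDirectedOrder Λ] [Nonempty Λ]
    {p : Λ → ContCStarSeminorm A} (hp : Monotone p) (hcof : ∀ q, ∃ i, q ≤ p i)
    (x : ∀ i, (p i).Compl)
    (hx : ∀ {i j} (h : j ≤ i), (ContCStarSeminorm.complSystem hp).map h (x i) = x j) :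
    ∃ a : A, ∀ i, (p i).toCompl a = x i := by
  have hanti : Antitone fun i => comap (p i).toCompl (𝓝 (x i)) := by
    intro j i h
    rw [← tendsto_iff_comap, ← hx h]
    exact (((ContCStarSeminorm.continuous_complMap (hp h)).tendsto (x i)).comp
      tendsto_comap).congr (ContCStarSeminorm.complMap_toCompl (hp h))
  have hclosure : x ∈ closure (Set.range fun (a : A) i => (p i).toCompl a) := by
    rw [mem_closure_iff_frequently, ← comap_neBot_iff_frequently, nhds_pi, Filter.pi, comap_iInf]
    simp only [comap_comap]
    exact iInf_neBot_of_directed hanti.directed_ge fun i => comap_neBot_iff_frequently.2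
      (mem_closure_iff_frequently.1 ((p i).denseRange_toCompl (x i)))
  have hclosed := (isUniformInducing_toCompl hcof).isComplete_range.isClosed
  obtain ⟨a, ha⟩ := hclosed.closure_eq ▸ hclosure
  exact ⟨a, congrFun ha⟩

/-- A locally C⋆-algebra is the inverse limit of its completions with respect to a cofinal
increasing family of continuous C⋆-seminorms (Arens–Michael). -/
def complLimit {Λ : Type*} [Preorder Λ] [IsDirectedOrder Λ] [Nonempty Λ]
    {p : Λ → ContCStarSeminorm A} (hp : Monotone p) (hcof : ∀ q, ∃ i, q ≤ p i) :
    (ContCStarSeminorm.complSystem hp).Limit A where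
  proj i := (p i).toComplHom
  map_proj h a := ContCStarSeminorm.complMap_toCompl (hp h) a
  existsUnique x hx := by
    obtain ⟨a, ha⟩ := exists_toCompl_eq hp hcof x hx
    refine ⟨a, ha, fun b hb => (isUniformInducing_toCompl hcof).injective ?_⟩
    exact funext fun i => (hb i).trans (ha i).symm
  isInducing := (isUniformInducing_toCompl hcof).isInducing

end IsLocallyCStarAlgebra

/-! ### Invariant seminorms -/

namespace ContStarAut

section OfMonoidHom

variable {G A : Type*} [Group G] [NonUnitalRing A] [StarRing A] [Module ℂ A] [TopologicalSpace A]

/-- An action by continuous ⋆-endomorphisms is an action by automorphisms. -/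
def ofMonoidHom (f : G →* (A →⋆ₙₐ[ℂ] A)) (hf : ∀ g, Continuous (f g)) : G →* ContStarAut A where
  toFun g :=
    { val :=
        { f g with
          toFun := f g
          invFun := f g⁻¹
          left_inv x := by
            change (f g⁻¹ * f g) x = x
            rw [← map_mul, inv_mul_cancel, map_one]
            rfl
          right_inv x := by
            change (f g * f g⁻¹) x = x
            rw [← map_mul, mul_inv_cancel, map_one]
            rfl }
      property := ⟨hf g, hf g⁻¹⟩ }
  map_one' := Subtype.ext (StarAlgEquiv.ext fun x => DFunLike.congr_fun (map_one f) x)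
  map_mul' g h := Subtype.ext (StarAlgEquiv.ext fun x => DFunLike.congr_fun (map_mul f g h) x)

theorem eq_of_eqOn_dense_span [T2Space A] {α α' : G →* ContStarAut A} {s : Set A}
    (hs : Dense (Submodule.span ℂ s : Set A)) (h : ∀ g, Set.EqOn (α g).1 (α' g).1 s) : α = α' :=
  MonoidHom.ext fun g => Subtype.ext (ext_of_dense_span (α g).2.1 (α' g).2.1 hs (h g))

end OfMonoidHom

section InvariantSeminorms

universe u

variable {G : Type*} [Group G] {A : Type u} [NonUnitalRing A] [StarRing A] [Module ℂ A]

/-- The continuous C⋆-seminorms which are invariant under an action. -/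
abbrev InvariantSeminorm [TopologicalSpace A] (α : G →* ContStarAut A) : Type u :=
  {p : ContCStarSeminorm A // ∀ (g : G) (a : A), p ((α g).1 a) = p a}

instance [TopologicalSpace A] (α : G →* ContStarAut A) : SemilatticeSup (InvariantSeminorm α) :=
  Subtype.semilatticeSup fun {p q} hp hq g a => by
    rw [ContCStarSeminorm.sup_apply, ContCStarSeminorm.sup_apply, hp, hq]

instance [TopologicalSpace A] (α : G →* ContStarAut A) : Nonempty (InvariantSeminorm α) :=
  ⟨⟨⊥, fun _ _ => rfl⟩⟩

theorem HasCofinalInvariantSeminorms.of_exists_apply_le [TopologicalSpace A]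
    {α : G →* ContStarAut A}
    (h : ∀ q, ∃ p : ContCStarSeminorm A, (∀ g a, p ((α g).1 a) ≤ p a) ∧ q ≤ p) :
    HasCofinalInvariantSeminorms α := fun q => by
  obtain ⟨p, hp, hqp⟩ := h q
  refine ⟨p, fun g a => (hp g a).antisymm ?_, hqp⟩
  have hinv : (α g⁻¹).1 ((α g).1 a) = a := by
    change (α g⁻¹ * α g).1 a = a
    rw [← map_mul, inv_mul_cancel, map_one]
    rfl
  simpa only [hinv] using hp g⁻¹ ((α g).1 a)

theorem HasCofinalInvariantSeminorms.exists_le [TopologicalSpace A] {α : G →* ContStarAut A}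
    (hα : HasCofinalInvariantSeminorms α)
    (q : ContCStarSeminorm A) : ∃ p : InvariantSeminorm α, q ≤ p.1 :=
  let ⟨p, hp, hqp⟩ := hα q
  ⟨⟨p, hp⟩, hqp⟩

variable [UniformSpace A] [IsLocallyCStarAlgebra A] {α : G →* ContStarAut A}

theorem HasCofinalInvariantSeminorms.equicontinuous (hα : HasCofinalInvariantSeminorms α) :
    Equicontinuous fun (g : G) (a : A) => (α g).1 a := by
  refine equicontinuous_of_equicontinuousAt_zero (fun g => (α g).1) fun U hU => ?_
  have hinv : Tendsto (fun x : A × G => (α x.2).1 x.1) (𝓝 0 ×ˢ ⊤) (𝓝 0) := by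
    refine (tendsto_iInf.2 fun p => tendsto_comap_iff.2 ?_).mono_right
      (IsLocallyCStarAlgebra.nhds_zero_eq_iInf hα.exists_le).ge
    exact (p.1.tendsto_zero.comp tendsto_fst).congr
      fun x => (p.2 x.2 x.1).symm
  rw [uniformity_eq_comap_nhds_zero] at hU
  obtain ⟨V, hV, hVU⟩ := hU
  filter_upwards [mem_prod_top.1 (hinv hV)] with a ha g
  refine hVU (?_ : (α g).1 a - (α g).1 0 ∈ V)
  rw [map_zero, sub_zero]
  exact ha g

theorem HasCofinalInvariantSeminorms.isContinuousAction [TopologicalSpace G]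
    (hα : HasCofinalInvariantSeminorms α) {s : Set A}
    (hs : Dense (Submodule.span ℂ s : Set A))
    (h : ∀ a ∈ s, Continuous fun g => (α g).1 a) : IsContinuousAction α := by
  have hspan : ∀ a ∈ Submodule.span ℂ s, Continuous fun g => (α g).1 a := by
    intro a ha
    induction ha using Submodule.span_induction with
    | mem a ha => exact h a ha
    | zero => simpa only [map_zero] using continuous_const
    | add a b _ _ ha hb => simp only [map_add]; exact ha.add hb
    | smul c a _ ha => simp only [map_smul]; exact ha.const_smul c
  exact fun a => continuous_iff_continuousAt.2 fun g =>
    (hα.equicontinuous a).tendsto_of_mem_closure (α g).2.1.continuousWithinAt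
      (fun b hb => (hspan b hb).tendsto g) (hs a)

/-- The action induced on the completion with respect to an invariant seminorm. -/
def complAction (p : InvariantSeminorm α) : G →* ContStarAut p.1.Compl :=
  ofMonoidHom
    { toFun g := ContCStarSeminorm.complMap p.1 p.1 ((α g).1 : A →⋆ₙₐ[ℂ] A) fun a => (p.2 g a).le
      map_one' := NonUnitalStarAlgHom.ext fun x =>
        ContCStarSeminorm.complMap_eq_self _ (fun a => by rw [map_one]; rfl) x
      map_mul' g h := NonUnitalStarAlgHom.ext fun x =>
        (ContCStarSeminorm.complMap_complMap (fun a => (p.2 h a).le) (fun a => (p.2 g a).le) _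
          (fun a => by rw [map_mul]; rfl) x).symm }
    fun g => ContCStarSeminorm.continuous_complMap fun a => (p.2 g a).le

theorem HasCofinalInvariantSeminorms.isInverseLimitAction
    (hα : HasCofinalInvariantSeminorms α) : IsInverseLimitAction α := by
  refine ⟨InvariantSeminorm α, inferInstance, inferInstance, inferInstance,
    ContCStarSeminorm.complSystem (Subtype.mono_coe _),
    IsLocallyCStarAlgebra.complLimit (Subtype.mono_coe _) hα.exists_le, complAction,
    fun g p q h x => ?_, fun g p a => ?_⟩
  · have hχ (a : A) : q.1 ((α g).1 a) ≤ p.1 a := (q.2 g a).trans_le (h a)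
    exact (ContCStarSeminorm.complMap_complMap (φ := ((α g).1 : A →⋆ₙₐ[ℂ] A))
        (fun a => (p.2 g a).le) h hχ (fun _ => rfl) x).trans
      (ContCStarSeminorm.complMap_complMap (ψ := ((α g).1 : A →⋆ₙₐ[ℂ] A))
        h (fun a => (q.2 g a).le) hχ (fun _ => rfl) x).symm
  · exact (ContCStarSeminorm.complMap_toCompl (φ := ((α g).1 : A →⋆ₙₐ[ℂ] A))
      (fun a => (p.2 g a).le) a).symm

end InvariantSeminorms

end ContStarAut

/-! ### Topology of Hilbert modules and of `L(E)` -/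

namespace HilbertModule

variable {A E : Type*} [NonUnitalRing A] [StarRing A] [Module ℂ A] [UniformSpace A]
  [AddCommGroup E] [Module ℂ E] [UniformSpace E] [HilbertModule A E]

theorem sub_rmul (ξ η : E) (a : A) : rmul (ξ - η) a = rmul ξ a - rmul η a := by
  rw [eq_sub_iff_add_eq, ← add_rmul, sub_add_cancel]

theorem AdjointPair.rightLinear {T S : Module.End ℂ E} (h : AdjointPair A T S) :
    RightLinear A T := fun ξ a => ext_inner_left A fun ζ => by
  rw [inner_rmul_right, ← h.symm, ← h.symm, inner_rmul_right]

theorem bar_mono {p q : ContCStarSeminorm A} (h : p ≤ q) (ξ : E) : bar p ξ ≤ bar q ξ :=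
  Real.sqrt_le_sqrt (h _)

variable [IsLocallyCStarAlgebra A]

/-- `bar p` as a bundled seminorm. -/
def barSeminorm (p : ContCStarSeminorm A) : Seminorm ℂ E :=
  .of (bar p) (bar_add_le p) (bar_smul p)

variable (A E) in
theorem withSeminorms : WithSeminorms (barSeminorm : ContCStarSeminorm A → Seminorm ℂ E) :=
  have := isUniformAddGroup (A := A) (E := E)
  (SeminormFamily.withSeminorms_iff_nhds_eq_iInf _).2 nhds_zero

theorem continuous_bar (p : ContCStarSeminorm A) : Continuous (bar p : E → ℝ) :=
  (withSeminorms A E).continuous_seminorm p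

section

variable (A E)

include A

theorem continuousSMul : ContinuousSMul ℂ E :=
  (withSeminorms A E).continuousSMul

theorem t2Space : T2Space E := by
  have := isUniformAddGroup (A := A) (E := E)
  have : T1Space E := (withSeminorms A E).T1_of_separating fun ξ hξ => by
    contrapose! hξ
    have hinner : inner A ξ ξ = 0 := tendsto_nhds_unique (l := pure ()) tendsto_const_nhds <|
      IsLocallyCStarAlgebra.tendsto_iff.2 fun p => by
        have hbar : bar p ξ = 0 := hξ p
        simpa only [sub_zero, ← bar_sq, hbar, sq, zero_mul] using tendsto_const_nhds
    exact (inner_self_eq_zero (A := A) ξ).1 hinner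
  infer_instance

end

theorem tendsto_bar_sub (p : ContCStarSeminorm A) {X : Type*} {l : Filter X} {f : X → E} {ξ : E}
    (hf : Tendsto f l (𝓝 ξ)) : Tendsto (fun x => bar p (f x - ξ)) l (𝓝 0) := by
  have := isUniformAddGroup (A := A) (E := E)
  simpa only [sub_self, bar_zero, Function.comp_def] using
    ((continuous_bar p).tendsto _).comp (hf.sub_const ξ)

theorem tendsto_inner {X : Type*} {l : Filter X} {f h : X → E} {ξ η : E}
    (hf : Tendsto f l (𝓝 ξ)) (hh : Tendsto h l (𝓝 η)) :
    Tendsto (fun x => inner A (f x) (h x)) l (𝓝 (inner A ξ η)) := by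
  refine IsLocallyCStarAlgebra.tendsto_iff.2 fun p => ?_
  have hbound : Tendsto (fun x => bar p (f x - ξ) * bar p (h x) + bar p ξ * bar p (h x - η))
      l (𝓝 0) := by
    simpa only [zero_mul, mul_zero, add_zero, Function.comp_def] using
      ((tendsto_bar_sub p hf).mul (((continuous_bar p).tendsto η).comp hh)).add
        ((tendsto_bar_sub p hh).const_mul (bar p ξ))
  refine squeeze_zero (fun _ => apply_nonneg p _) (fun x => ?_) hbound
  have hsplit : inner A (f x) (h x) - inner A ξ η =
      inner A (f x - ξ) (h x) + inner A ξ (h x - η) := by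
    rw [inner_sub_left, inner_sub_right]
    abel
  rw [hsplit]
  exact (map_add_le_add p _ _).trans (add_le_add (apply_inner_le p _ _) (apply_inner_le p _ _))

namespace Adjointable

/-- The operator `T`, with adjoint `S`. -/
def ofAdjointPair {T S : Module.End ℂ E} (h : AdjointPair A T S) : Adjointable A E :=
  ⟨T, h.rightLinear, S, h.symm.rightLinear, h⟩

section Topology

theorem nhds_zero_hasBasis : (𝓝 (0 : Adjointable A E)).HasBasis
    (fun i : Finset (ContCStarSeminorm A) × ℝ => 0 < i.2) fun i => ball i.1 i.2 :=
  filterBasis.nhds_zero_hasBasis.to_hasBasis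
    (by rintro _ ⟨F, ε, hε, rfl⟩; exact ⟨(F, ε), hε, subset_rfl⟩)
    fun i hi => ⟨ball i.1 i.2, ⟨i.1, i.2, hi, rfl⟩, subset_rfl⟩

instance : ContinuousStar (Adjointable A E) where
  continuous_star := by
    refine continuous_of_continuousAt_zero (starAddEquiv (R := Adjointable A E)) ?_
    rw [ContinuousAt, map_zero, nhds_zero_hasBasis.tendsto_iff nhds_zero_hasBasis]
    exact fun i hi => ⟨i, hi, fun T hT => star_mem_ball (le_of_lt hi) hT⟩

variable (A E) in
/-- The map which takes an operator to the underlying function, as an additive map. -/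
def coeHom : Adjointable A E →+ (E → E) := AddMonoidHom.mk' (⇑) fun _ _ => rfl

theorem continuous_coeHom : Continuous (coeHom A E) := by
  have := HilbertModule.isUniformAddGroup (A := A) (E := E)
  refine continuous_of_continuousAt_zero _ (tendsto_pi_nhds.2 fun ξ => ?_)
  rw [map_zero, Pi.zero_apply, HilbertModule.nhds_zero (A := A)]
  refine tendsto_iInf.2 fun p => tendsto_comap_iff.2 ?_
  rw [nhds_zero_hasBasis.tendsto_iff Metric.nhds_basis_closedBall]
  intro ε hε
  have hpos : 0 < bar p ξ + 1 := add_pos_of_nonneg_of_pos (bar_nonneg p ξ) one_pos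
  refine ⟨({p}, ε / (bar p ξ + 1)), div_pos hε hpos, fun T hT => ?_⟩
  rw [mem_closedBall_zero_iff]
  change ‖bar p (T ξ)‖ ≤ ε
  rw [Real.norm_of_nonneg (bar_nonneg p _)]
  calc bar p (T ξ) ≤ ε / (bar p ξ + 1) * bar p ξ := hT p (Finset.mem_singleton_self p) ξ
    _ ≤ ε / (bar p ξ + 1) * (bar p ξ + 1) := by gcongr; linarith
    _ = ε := div_mul_cancel₀ _ hpos.ne'

instance : T2Space (Adjointable A E) :=
  have := HilbertModule.t2Space A E
  .of_injective_continuous (f := coeHom A E) DFunLike.coe_injective continuous_coeHom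

end Topology

section Complete

variable (A E) in
/-- The uniform structure of `L(E)`. -/
abbrev uniformSpace : UniformSpace (Adjointable A E) :=
  IsTopologicalAddGroup.rightUniformSpace _

attribute [local instance] uniformSpace

theorem isUniformAddGroup : IsUniformAddGroup (Adjointable A E) :=
  isUniformAddGroup_of_addCommGroup

attribute [local instance] isUniformAddGroup

theorem exists_tendsto_coe {l : Filter (Adjointable A E)} (hl : Cauchy l) :
    ∃ T : Module.End ℂ E, ∀ ξ, Tendsto (fun S : Adjointable A E => S ξ) l (𝓝 (T ξ)) := by
  have := HilbertModule.isUniformAddGroup (A := A) (E := E)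
  have := HilbertModule.complete (A := A) (E := E)
  have := HilbertModule.t2Space A E
  have := HilbertModule.continuousSMul A E
  have := hl.1
  obtain ⟨T, hT⟩ := CompleteSpace.complete
    (hl.map (uniformContinuous_addMonoidHom_of_continuous continuous_coeHom))
  exact ⟨linearMapOfTendsto T (fun S : Adjointable A E => S.1) hT, tendsto_pi_nhds.1 hT⟩

theorem exists_tendsto_apply {l : Filter (Adjointable A E)} (hl : Cauchy l) :
    ∃ T : Adjointable A E, ∀ ξ, Tendsto (fun S : Adjointable A E => S ξ) l (𝓝 (T ξ)) := by
  have := hl.1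
  obtain ⟨T, hT⟩ := exists_tendsto_coe hl
  obtain ⟨S, hS⟩ := exists_tendsto_coe (hl.map
    (uniformContinuous_addMonoidHom_of_continuous (f := starAddEquiv (R := Adjointable A E))
      continuous_star))
  have hTS : AdjointPair A T S := fun ξ η =>
    tendsto_nhds_unique (tendsto_inner (hT ξ) tendsto_const_nhds) <|
      (tendsto_inner tendsto_const_nhds (tendsto_map'_iff.1 (hS η))).congr fun R =>
        (inner_apply_left R ξ η).symm
  exact ⟨ofAdjointPair hTS, hT⟩

theorem le_nhds_of_tendsto_apply {l : Filter (Adjointable A E)} (hl : Cauchy l)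
    {T : Adjointable A E} (hT : ∀ ξ, Tendsto (fun S : Adjointable A E => S ξ) l (𝓝 (T ξ))) :
    l ≤ 𝓝 T := by
  have := HilbertModule.isUniformAddGroup (A := A) (E := E)
  have := hl.1
  rw [← nhds_translation_sub, ← tendsto_iff_comap, nhds_zero_hasBasis.tendsto_right_iff]
  rintro ⟨F, ε⟩ hε
  have hU : {x : Adjointable A E × Adjointable A E | x.2 - x.1 ∈ ball F ε} ∈
      uniformity (Adjointable A E) := by
    rw [uniformity_eq_comap_nhds_zero]
    exact preimage_mem_comap (nhds_zero_hasBasis.mem_of_mem (i := (F, ε)) hε)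
  obtain ⟨s, hs, hsU⟩ := (cauchy_iff.1 hl).2 _ hU
  filter_upwards [hs] with R hR p hp ξ
  have hlim : Tendsto (fun R' : Adjointable A E => bar p (R ξ - R' ξ)) l
      (𝓝 (bar p (R ξ - T ξ))) :=
    ((continuous_bar p).tendsto _).comp ((hT ξ).const_sub (R ξ))
  refine le_of_tendsto hlim ?_
  filter_upwards [hs] with R' hR'
  exact hsU (Set.mk_mem_prod hR' hR) p hp ξ

theorem completeSpace : CompleteSpace (Adjointable A E) where
  complete hl :=
    let ⟨T, hT⟩ := exists_tendsto_apply hl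
    ⟨T, le_nhds_of_tendsto_apply hl hT⟩

end Complete

section Bounds

variable {F : Finset (ContCStarSeminorm A)} {p q : ContCStarSeminorm A} {T S : Adjointable A E}
  {M N : ℝ}

theorem mem_ball_singleton : T ∈ ball {p} M ↔ ∀ ξ, bar p (T ξ) ≤ M * bar p ξ := by
  simp only [ball, Finset.mem_singleton, forall_eq, Set.mem_ofPred_eq]

theorem zero_mem_ball (hM : 0 ≤ M) : (0 : Adjointable A E) ∈ ball F M := fun p _ ξ => by
  rw [zero_apply, bar_zero]
  exact mul_nonneg hM (bar_nonneg p ξ)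

theorem one_mem_ball : (1 : Adjointable A E) ∈ ball F 1 := fun _ _ _ => (one_mul _).ge

theorem add_mem_ball (hT : T ∈ ball F M) (hS : S ∈ ball F N) : T + S ∈ ball F (M + N) :=
  fun p hp ξ => by
    rw [add_apply, add_mul]
    exact (bar_add_le p _ _).trans (add_le_add (hT p hp ξ) (hS p hp ξ))

theorem smul_mem_ball (c : ℂ) (hT : T ∈ ball F M) : c • T ∈ ball F (‖c‖ * M) := fun p hp ξ => by
  rw [smul_apply, bar_smul, mul_assoc]
  exact mul_le_mul_of_nonneg_left (hT p hp ξ) (norm_nonneg c)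

theorem mul_mem_ball (hM : 0 ≤ M) (hT : T ∈ ball F M) (hS : S ∈ ball F N) :
    T * S ∈ ball F (M * N) := fun p hp ξ => by
  rw [mul_apply, mul_assoc]
  exact (hT p hp _).trans (mul_le_mul_of_nonneg_left (hS p hp ξ) hM)

theorem pow_mem_ball (hM : 0 ≤ M) (hT : T ∈ ball F M) (n : ℕ) : T ^ n ∈ ball F (M ^ n) := by
  induction n with
  | zero => simpa only [pow_zero] using one_mem_ball
  | succ n ih => simpa only [pow_succ] using mul_mem_ball (pow_nonneg hM n) ih hT

theorem sq_bar_apply_le (p : ContCStarSeminorm A) (T : Adjointable A E) (ξ : E) :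
    bar p (T ξ) ^ 2 ≤ bar p ξ * bar p ((star T * T) ξ) := by
  rw [bar_sq, inner_apply_left]
  exact apply_inner_le p ξ _

theorem mem_ball_of_star_mul_self_mem_ball (hM : 0 ≤ M) (h : star T * T ∈ ball F (M ^ 2)) :
    T ∈ ball F M := fun p hp ξ => by
  refine le_of_sq_le_sq ?_ (mul_nonneg hM (bar_nonneg p ξ))
  calc bar p (T ξ) ^ 2 ≤ bar p ξ * bar p ((star T * T) ξ) := sq_bar_apply_le p T ξ
    _ ≤ bar p ξ * (M ^ 2 * bar p ξ) := mul_le_mul_of_nonneg_left (h p hp ξ) (bar_nonneg p ξ)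
    _ = (M * bar p ξ) ^ 2 := by ring

theorem bar_apply_pow_two_pow_mul_le (p : ContCStarSeminorm A) (hT : IsSelfAdjoint T) (n : ℕ)
    (ξ : E) :
    bar p (T ξ) ^ 2 ^ n * bar p ξ ≤ bar p ξ ^ 2 ^ n * bar p ((T ^ 2 ^ n) ξ) := by
  induction n generalizing T with
  | zero => simp only [pow_zero, pow_one, mul_comm, le_refl]
  | succ n ih =>
    have hsq : bar p (T ξ) ^ 2 ≤ bar p ξ * bar p ((T ^ 2) ξ) := by
      simpa only [hT.star_eq, ← sq] using sq_bar_apply_le p T ξ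
    calc bar p (T ξ) ^ 2 ^ (n + 1) * bar p ξ
        = (bar p (T ξ) ^ 2) ^ 2 ^ n * bar p ξ := by rw [← pow_mul, ← pow_succ']
      _ ≤ (bar p ξ * bar p ((T ^ 2) ξ)) ^ 2 ^ n * bar p ξ := by
        gcongr
        exact bar_nonneg p ξ
      _ = bar p ξ ^ 2 ^ n * (bar p ((T ^ 2) ξ) ^ 2 ^ n * bar p ξ) := by ring
      _ ≤ bar p ξ ^ 2 ^ n * (bar p ξ ^ 2 ^ n * bar p (((T ^ 2) ^ 2 ^ n) ξ)) :=
        mul_le_mul_of_nonneg_left (ih (hT.pow 2)) (pow_nonneg (bar_nonneg p ξ) _)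
      _ = bar p ξ ^ 2 ^ (n + 1) * bar p ((T ^ 2 ^ (n + 1)) ξ) := by
        rw [← pow_mul, ← pow_succ', pow_succ' 2 n]
        ring

theorem mem_ball_singleton_of_le (h : q ≤ p) (hT : IsSelfAdjoint T) (hM : 0 ≤ M)
    (hb : T ∈ ball {p} M) : T ∈ ball {q} M := by
  refine mem_ball_singleton.2 fun ξ => ?_
  rcases (bar_nonneg q ξ).eq_or_lt with h0 | hpos
  · have hsq := sq_bar_apply_le q T ξ
    rw [← h0, zero_mul] at hsq
    rw [← h0, mul_zero]
    exact (pow_eq_zero_iff two_ne_zero).1 (hsq.antisymm (sq_nonneg _)) |>.le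
  · refine le_of_forall_pow_le_const_mul_pow (C := bar p ξ / bar q ξ) (by positivity)
      (tendsto_pow_atTop_atTop_of_one_lt one_lt_two) fun n => ?_
    rw [div_mul_eq_mul_div, le_div_iff₀ hpos]
    -- `p̄ (T^(2^n) ξ) ≤ M^(2^n) p̄ ξ`, and the factor `p̄ ξ / q̄ ξ` disappears in the limit
    -- `p̄ (T^(2^n) ξ) ≤ M^(2^n) p̄ ξ`, and the factor `p̄ ξ / q̄ ξ` disappears in the limit
    calc bar q (T ξ) ^ 2 ^ n * bar q ξ
        ≤ bar q ξ ^ 2 ^ n * bar q ((T ^ 2 ^ n) ξ) := bar_apply_pow_two_pow_mul_le q hT n ξ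
      _ ≤ bar q ξ ^ 2 ^ n * (M ^ 2 ^ n * bar p ξ) := by
        gcongr
        exact (bar_mono h _).trans (mem_ball_singleton.1 (pow_mem_ball hM hb _) ξ)
      _ = bar p ξ * (M * bar q ξ) ^ 2 ^ n := by ring

theorem ball_singleton_subset (hF : ∀ q ∈ F, q ≤ p) (hM : 0 ≤ M) :
    (ball {p} M : Set (Adjointable A E)) ⊆ ball F M := fun T hT q hq =>
  have hTT : star T * T ∈ ball {p} (M ^ 2) :=
    sq M ▸ mul_mem_ball hM (star_mem_ball hM hT) hT
  mem_ball_singleton.1 <| mem_ball_of_star_mul_self_mem_ball hM <|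
    mem_ball_singleton_of_le (hF q hq) (.star_mul_self T) (sq_nonneg M) hTT

end Bounds

end Adjointable

end HilbertModule

/-! ### `K(E)` as a locally C⋆-algebra -/

namespace HilbertModule

namespace Compact

open Adjointable

variable {A E : Type*} [NonUnitalRing A] [StarRing A] [Module ℂ A] [UniformSpace A]
  [AddCommGroup E] [Module ℂ E] [UniformSpace E] [HilbertModule A E] [IsLocallyCStarAlgebra A]
  {p : ContCStarSeminorm A}

section Seminorm

variable (A E) in
/-- The inclusion of `K(E)` into `L(E)`. -/
def inclusion : Compact A E →ₗ[ℂ] Adjointable A E where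
  toFun T := T.1
  map_add' _ _ := rfl
  map_smul' _ _ := rfl

theorem isInducing_inclusion : IsInducing (inclusion A E) := IsInducing.subtypeVal

theorem nhds_zero_hasBasis : (𝓝 (0 : Compact A E)).HasBasis
    (fun i : Finset (ContCStarSeminorm A) × ℝ => 0 < i.2) fun i => {T | T.1 ∈ ball i.1 i.2} := by
  rw [isInducing_inclusion.nhds_eq_comap, map_zero]
  exact Adjointable.nhds_zero_hasBasis.comap _

/-- The operator seminorm `p̃ T = sup {p̄_E (T ξ) | p̄_E ξ ≤ 1}`, encoded as the least bound of `T`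
with respect to `p̄_E`; this bound exists because `T` is compact. -/
def opNorm (p : ContCStarSeminorm A) (T : Compact A E) : ℝ :=
  sInf {M | 0 ≤ M ∧ T.1 ∈ ball {p} M}

theorem opNorm_nonneg (p : ContCStarSeminorm A) (T : Compact A E) : 0 ≤ opNorm p T :=
  Real.sInf_nonneg fun _ hM => hM.1

theorem mem_ball_opNorm (p : ContCStarSeminorm A) (T : Compact A E) :
    T.1 ∈ ball {p} (opNorm p T) := by
  obtain ⟨M, hM, hTM⟩ := exists_bound_of_mem_closure p T.2
  refine mem_ball_singleton.2 fun ξ => ?_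
  rcases (bar_nonneg p ξ).eq_or_lt with h0 | hpos
  · simpa only [← h0, mul_zero] using hTM ξ
  · rw [← div_le_iff₀ hpos]
    exact le_csInf ⟨M, hM, mem_ball_singleton.2 hTM⟩ fun N hN =>
      (div_le_iff₀ hpos).2 (mem_ball_singleton.1 hN.2 ξ)

theorem opNorm_le_iff {T : Compact A E} {M : ℝ} (hM : 0 ≤ M) :
    opNorm p T ≤ M ↔ T.1 ∈ ball {p} M :=
  ⟨fun h q hq ξ => (mem_ball_opNorm p T q hq ξ).trans
      (mul_le_mul_of_nonneg_right h (bar_nonneg q ξ)),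
    fun h => csInf_le ⟨0, fun _ hN => hN.1⟩ ⟨hM, h⟩⟩

theorem opNorm_star_mul_self (p : ContCStarSeminorm A) (T : Compact A E) :
    opNorm p (star T * T) = opNorm p T ^ 2 := by
  have hp := opNorm_nonneg p (star T * T)
  refine le_antisymm ?_ ?_
  · rw [opNorm_le_iff (sq_nonneg _), sq]
    exact mul_mem_ball (opNorm_nonneg p T)
      (star_mem_ball (opNorm_nonneg p T) (mem_ball_opNorm p T)) (mem_ball_opNorm p T)
  · rw [← Real.le_sqrt (opNorm_nonneg p T) hp, opNorm_le_iff (Real.sqrt_nonneg _)]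
    refine mem_ball_of_star_mul_self_mem_ball (Real.sqrt_nonneg _) ?_
    rw [Real.sq_sqrt hp]
    exact mem_ball_opNorm p (star T * T)

theorem opNorm_zero (p : ContCStarSeminorm A) : opNorm p (0 : Compact A E) = 0 :=
  ((opNorm_le_iff le_rfl).2 (zero_mem_ball le_rfl)).antisymm (opNorm_nonneg p 0)

/-- The operator seminorm attached to `p`, as a continuous C⋆-seminorm of `K(E)`. -/
def seminorm (p : ContCStarSeminorm A) : ContCStarSeminorm (Compact A E) where
  toSeminorm := .ofSMulLE (opNorm p) (opNorm_zero p)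
    (fun T S => (opNorm_le_iff (add_nonneg (opNorm_nonneg p T) (opNorm_nonneg p S))).2 <|
      add_mem_ball (mem_ball_opNorm p T) (mem_ball_opNorm p S))
    fun c T => (opNorm_le_iff (mul_nonneg (norm_nonneg c) (opNorm_nonneg p T))).2 <|
      smul_mem_ball c (mem_ball_opNorm p T)
  mul_le' T S := (opNorm_le_iff (mul_nonneg (opNorm_nonneg p T) (opNorm_nonneg p S))).2 <|
    mul_mem_ball (opNorm_nonneg p T) (mem_ball_opNorm p T) (mem_ball_opNorm p S)
  star_mul_self' := opNorm_star_mul_self p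
  continuous' := by
    have : IsTopologicalAddGroup (Compact A E) :=
      isInducing_inclusion.topologicalAddGroup (inclusion A E)
    refine Seminorm.continuous_of_continuousAt_zero ?_
    change Tendsto (opNorm p) (𝓝 0) (𝓝 (opNorm p 0))
    rw [opNorm_zero, nhds_zero_hasBasis.tendsto_iff Metric.nhds_basis_closedBall]
    refine fun ε hε => ⟨({p}, ε), hε, fun T hT => ?_⟩
    rw [mem_closedBall_zero_iff]
    exact (Real.norm_of_nonneg (opNorm_nonneg p T)).trans_le ((opNorm_le_iff hε.le).2 hT)

theorem seminorm_le_iff {T : Compact A E} {M : ℝ} (hM : 0 ≤ M) :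
    seminorm p T ≤ M ↔ ∀ ξ, bar p (T.1 ξ) ≤ M * bar p ξ :=
  (opNorm_le_iff hM).trans mem_ball_singleton

theorem bar_apply_le (p : ContCStarSeminorm A) (T : Compact A E) (ξ : E) :
    bar p (T.1 ξ) ≤ seminorm p T * bar p ξ :=
  (seminorm_le_iff (apply_nonneg _ T)).1 le_rfl ξ

theorem mem_ball_of_seminorm_le {F : Finset (ContCStarSeminorm A)} (hF : ∀ q ∈ F, q ≤ p)
    {T : Compact A E} {M : ℝ} (hM : seminorm p T ≤ M) : T.1 ∈ ball F M := by
  have hM₀ : 0 ≤ M := (apply_nonneg _ T).trans hM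
  exact ball_singleton_subset hF hM₀ ((opNorm_le_iff hM₀).1 hM)

theorem seminorm_mono :
    Monotone (seminorm : ContCStarSeminorm A → ContCStarSeminorm (Compact A E)) :=
  fun _ _ h T => (opNorm_le_iff (apply_nonneg _ T)).2 <|
    mem_ball_of_seminorm_le (by simpa only [Finset.mem_singleton, forall_eq] using h) le_rfl

theorem exists_le_seminorm (q : ContCStarSeminorm (Compact A E)) :
    ∃ p : ContCStarSeminorm A, q ≤ seminorm p := by
  obtain ⟨⟨F, ε⟩, hε, hF⟩ := nhds_zero_hasBasis.mem_iff.1 (q.tendsto_zero (Iio_mem_nhds one_pos))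
  exact ⟨F.sup id, ContCStarSeminorm.le_of_forall_lt hε fun T hT =>
    hF (mem_ball_of_seminorm_le (fun _ hr => Finset.le_sup (f := id) hr) hT.le)⟩

end Seminorm

section LocallyCStarAlgebra

attribute [local instance] Adjointable.uniformSpace Adjointable.isUniformAddGroup
  Adjointable.completeSpace

variable (A E) in
/-- The uniform structure of `K(E)`, induced by that of `L(E)`. -/
abbrev uniformSpace : UniformSpace (Compact A E) :=
  instUniformSpaceSubtype

attribute [local instance] uniformSpace

variable (A E) in
theorem isLocallyCStarAlgebra : IsLocallyCStarAlgebra (Compact A E) where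
  smul_assoc c T S := Subtype.ext (smul_mul_assoc c T.1 S.1)
  smul_comm c T S := Subtype.ext (mul_smul_comm c T.1 S.1).symm
  star_smul c T := Subtype.ext (star_smul c T.1)
  toIsUniformAddGroup := IsUniformAddGroup.comap (inclusion A E)
  toCompleteSpace :=
    (isClosed_closure (s := (finiteRank A E : Set (Adjointable A E)))).completeSpace_coe
  toT2Space := IsEmbedding.subtypeVal.t2Space
  nhds_zero := by
    refine le_antisymm (le_iInf fun q => tendsto_iff_comap.1 q.tendsto_zero) ?_
    rw [nhds_zero_hasBasis.ge_iff]
    rintro ⟨F, ε⟩ hε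
    refine mem_of_superset (mem_iInf_of_mem (seminorm (F.sup id))
      (preimage_mem_comap (Iio_mem_nhds hε))) fun T hT => ?_
    exact mem_ball_of_seminorm_le (fun _ hr => Finset.le_sup (f := id) hr) (le_of_lt hT)

end LocallyCStarAlgebra

section Theta

variable (A E) in
theorem dense_span_theta :
    Dense (Submodule.span ℂ (Set.range fun x : E × E => theta A x.1 x.2) : Set (Compact A E)) := by
  intro T
  rw [isInducing_inclusion.closure_eq_preimage_closure_image, ← Submodule.map_coe,
    Submodule.map_span, ← Set.range_comp]
  exact T.2

theorem seminorm_theta_le (p : ContCStarSeminorm A) (ξ η : E) :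
    seminorm p (theta A ξ η) ≤ bar p ξ * bar p η := by
  refine (seminorm_le_iff (mul_nonneg (bar_nonneg p ξ) (bar_nonneg p η))).2 fun ζ => ?_
  calc bar p (rmul ξ (inner A η ζ)) ≤ bar p ξ * p (inner A η ζ) := bar_rmul_le p ξ _
    _ ≤ bar p ξ * (bar p η * bar p ζ) :=
      mul_le_mul_of_nonneg_left (apply_inner_le p η ζ) (bar_nonneg p ξ)
    _ = bar p ξ * bar p η * bar p ζ := (mul_assoc _ _ _).symm

theorem theta_sub_theta (ξ η ξ' η' : E) :
    theta A ξ' η' - theta A ξ η = theta A (ξ' - ξ) η' + theta A ξ (η' - η) := by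
  refine Subtype.ext (Adjointable.ext fun ζ => ?_)
  change rmul ξ' (inner A η' ζ) - rmul ξ (inner A η ζ) =
    rmul (ξ' - ξ) (inner A η' ζ) + rmul ξ (inner A (η' - η) ζ)
  have hη : rmul ξ (inner A (η' - η) ζ) + rmul ξ (inner A η ζ) = rmul ξ (inner A η' ζ) := by
    rw [← rmul_add, ← inner_add_left, sub_add_cancel]
  rw [sub_rmul, ← hη]
  abel

theorem tendsto_theta {X : Type*} {l : Filter X} {f h : X → E} {ξ η : E}
    (hf : Tendsto f l (𝓝 ξ)) (hh : Tendsto h l (𝓝 η)) :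
    Tendsto (fun x => theta A (f x) (h x)) l (𝓝 (theta A ξ η)) := by
  let _ := uniformSpace A E
  have := isLocallyCStarAlgebra A E
  refine IsLocallyCStarAlgebra.tendsto_iff.2 fun q => ?_
  obtain ⟨p, hp⟩ := exists_le_seminorm q
  have hbound : Tendsto (fun x => bar p (f x - ξ) * bar p (h x) + bar p ξ * bar p (h x - η))
      l (𝓝 0) := by
    simpa only [zero_mul, mul_zero, add_zero, Function.comp_def] using
      ((tendsto_bar_sub p hf).mul (((continuous_bar p).tendsto η).comp hh)).add
        ((tendsto_bar_sub p hh).const_mul (bar p ξ))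
  refine squeeze_zero (fun _ => apply_nonneg q _) (fun x => (hp _).trans ?_) hbound
  rw [theta_sub_theta]
  exact (map_add_le_add _ _ _).trans <|
    add_le_add (seminorm_theta_le p _ _) (seminorm_theta_le p _ _)

end Theta

end Compact

end HilbertModule

/-! ### The actions of `Aut(E)` on `A` and on `K(E)` -/

namespace HilbertAut

open HilbertModule

variable {A E : Type*} [NonUnitalRing A] [StarRing A] [Module ℂ A] [UniformSpace A]
  [AddCommGroup E] [Module ℂ E] [UniformSpace E] [HilbertModule A E]

section Hom

/-- A continuous ⋆-endomorphism `α` of `A` with `⟨u ξ, u η⟩ = α ⟨ξ, η⟩`; it is determined by `u` if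
`E` is full. -/
def hom (u : HilbertAut A E) : A →⋆ₙₐ[ℂ] A := u.2.1.choose

theorem continuous_hom (u : HilbertAut A E) : Continuous (hom u) := u.2.1.choose_spec.1

theorem hom_inner (u : HilbertAut A E) (ξ η : E) :
    hom u (inner A ξ η) = inner A (u.1 ξ) (u.1 η) := (u.2.1.choose_spec.2 ξ η).symm

theorem apply_inv_apply (u : HilbertAut A E) (ξ : E) : u.1 ((u⁻¹).1 ξ) = ξ :=
  u.1.apply_symm_apply ξ

theorem inner_apply_left (u : HilbertAut A E) (ξ η : E) :
    inner A (u.1 ξ) η = hom u (inner A ξ ((u⁻¹).1 η)) := by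
  rw [hom_inner, apply_inv_apply]

theorem inner_apply_right (u : HilbertAut A E) (ξ η : E) :
    inner A ξ (u.1 η) = hom u (inner A ((u⁻¹).1 ξ) η) := by
  rw [hom_inner, apply_inv_apply]

/-- An automorphism of `E`, as a linear map. -/
def toLinearMap (u : HilbertAut A E) : E →ₗ[ℂ] E where
  toFun := u.1
  map_add' ξ η := ext_inner_left A fun ζ => by
    simp only [inner_apply_right, HilbertModule.inner_add_right, map_add]
  map_smul' c ξ := ext_inner_left A fun ζ => by
    simp only [inner_apply_right, HilbertModule.inner_smul_right, map_smul, RingHom.id_apply]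

theorem apply_rmul (u : HilbertAut A E) (ξ : E) (a : A) :
    u.1 (rmul ξ a) = rmul (u.1 ξ) (hom u a) := ext_inner_left A fun ζ => by
  simp only [inner_apply_right, inner_rmul_right, map_mul]

theorem bar_apply (p : ContCStarSeminorm A) (u : HilbertAut A E) (ξ : E) :
    bar p (u.1 ξ) = bar (p.comp (hom u) (continuous_hom u)) ξ :=
  congrArg (fun a => √(p a)) (hom_inner u ξ ξ).symm

variable [IsLocallyCStarAlgebra A]

/-- The action of `Aut(E)` on `A`, for a full Hilbert module `E`. -/
def toContStarAut (hE : IsFull A E) : HilbertAut A E →* ContStarAut A :=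
  ContStarAut.ofMonoidHom
    { toFun := hom
      map_one' := ext_of_dense_span (continuous_hom 1) continuous_id hE <| by
        rintro _ ⟨x, rfl⟩
        exact hom_inner 1 x.1 x.2
      map_mul' u v := ext_of_dense_span (continuous_hom (u * v))
          ((continuous_hom u).comp (continuous_hom v)) hE <| by
        rintro _ ⟨x, rfl⟩
        change hom (u * v) (inner A x.1 x.2) = hom u (hom v (inner A x.1 x.2))
        simp only [hom_inner]
        rfl }
    continuous_hom

theorem toContStarAut_inner (hE : IsFull A E) (u : HilbertAut A E) (ξ η : E) :
    (toContStarAut hE u).1 (inner A ξ η) = inner A (u.1 ξ) (u.1 η) := hom_inner u ξ η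

end Hom

section Conj

variable [IsLocallyCStarAlgebra A]

theorem adjointPair_conj (u : HilbertAut A E) (T : Adjointable A E) :
    AdjointPair A (toLinearMap u ∘ₗ T.1 ∘ₗ toLinearMap u⁻¹)
      (toLinearMap u ∘ₗ (star T).1 ∘ₗ toLinearMap u⁻¹) := fun ξ η => by
  change inner A (u.1 (T ((u⁻¹).1 ξ))) η = inner A ξ (u.1 (star T ((u⁻¹).1 η)))
  rw [inner_apply_left u (T ((u⁻¹).1 ξ)) η, inner_apply_right u ξ, Adjointable.inner_apply_left]

/-- Conjugation of adjointable operators by an automorphism of `E`. -/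
def conj (u : HilbertAut A E) : Adjointable A E →⋆ₙₐ[ℂ] Adjointable A E where
  toFun T := Adjointable.ofAdjointPair (adjointPair_conj u T)
  map_zero' := Adjointable.ext fun _ => (toLinearMap u).map_zero
  map_add' _ _ := Adjointable.ext fun _ => (toLinearMap u).map_add _ _
  map_smul' c _ := Adjointable.ext fun _ => (toLinearMap u).map_smul c _
  map_mul' T S := Adjointable.ext fun ξ =>
    congrArg (fun η => u.1 (T η)) (u.1.symm_apply_apply (S ((u⁻¹).1 ξ))).symm
  map_star' T := Adjointable.ext fun ξ => ext_inner_left A fun ζ => by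
    rw [← Adjointable.inner_apply_left]
    exact (adjointPair_conj u T ζ ξ).symm

theorem conj_apply (u : HilbertAut A E) (T : Adjointable A E) (ξ : E) :
    conj u T ξ = u.1 (T ((u⁻¹).1 ξ)) := rfl

theorem conj_rankOne (u : HilbertAut A E) (ξ η : E) :
    conj u (Adjointable.rankOne ξ η) = Adjointable.rankOne (u.1 ξ) (u.1 η) :=
  Adjointable.ext fun ζ => by
    rw [conj_apply, Adjointable.rankOne_apply, Adjointable.rankOne_apply, apply_rmul,
      inner_apply_left]

theorem bar_conj_le {u : HilbertAut A E} {p q : ContCStarSeminorm A}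
    (hu : ∀ ξ, bar p (u.1 ξ) = bar q ξ) {T : Adjointable A E} {M : ℝ}
    (hT : ∀ ξ, bar q (T ξ) ≤ M * bar q ξ) (ξ : E) : bar p (conj u T ξ) ≤ M * bar p ξ := by
  simpa only [conj_apply, ← hu, apply_inv_apply] using hT ((u⁻¹).1 ξ)

theorem continuous_conj (u : HilbertAut A E) : Continuous (conj u) := by
  classical
  refine continuous_of_continuousAt_zero (conj u) ?_
  rw [ContinuousAt, map_zero,
    Adjointable.nhds_zero_hasBasis.tendsto_iff Adjointable.nhds_zero_hasBasis]
  exact fun ⟨F, ε⟩ hε => ⟨(F.image fun p => p.comp (hom u) (continuous_hom u), ε), hε,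
    fun T hT p hp => bar_conj_le (bar_apply p u) (hT _ (Finset.mem_image_of_mem _ hp))⟩

theorem conj_mem_compact (u : HilbertAut A E) {T : Adjointable A E} (hT : T ∈ Compact A E) :
    conj u T ∈ Compact A E := by
  have hmap : (Adjointable.finiteRank A E).map (conj u : Adjointable A E →ₗ[ℂ] Adjointable A E) ≤
      Adjointable.finiteRank A E := by
    rw [Adjointable.finiteRank, Submodule.map_span, Submodule.span_le]
    rintro _ ⟨_, ⟨x, rfl⟩, rfl⟩
    exact Submodule.subset_span ⟨(u.1 x.1, u.1 x.2), (conj_rankOne u x.1 x.2).symm⟩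
  exact map_mem_closure (continuous_conj u) hT fun S hS => hmap (Submodule.mem_map_of_mem hS)

/-- Conjugation of compact operators by an automorphism of `E`. -/
def conjCompact (u : HilbertAut A E) : Compact A E →⋆ₙₐ[ℂ] Compact A E where
  toFun T := ⟨conj u T.1, conj_mem_compact u T.2⟩
  map_zero' := Subtype.ext (map_zero (conj u))
  map_add' T S := Subtype.ext (map_add (conj u) T.1 S.1)
  map_smul' c T := Subtype.ext (map_smul (conj u) c T.1)
  map_mul' T S := Subtype.ext (map_mul (conj u) T.1 S.1)
  map_star' T := Subtype.ext (map_star (conj u) T.1)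

theorem seminorm_conjCompact_le {p : ContCStarSeminorm A} {u : HilbertAut A E}
    (hu : ∀ ξ, bar p (u.1 ξ) = bar p ξ) (T : Compact A E) :
    Compact.seminorm p (conjCompact u T) ≤ Compact.seminorm p T :=
  (Compact.seminorm_le_iff (apply_nonneg _ T)).2 (bar_conj_le hu (Compact.bar_apply_le p T))

variable (A E) in
/-- The action of `Aut(E)` on `K(E)`. -/
def toContStarAutCompact : HilbertAut A E →* ContStarAut (Compact A E) :=
  ContStarAut.ofMonoidHom
    { toFun := conjCompact
      map_one' := rfl
      map_mul' _ _ := rfl }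
    fun u => ((continuous_conj u).comp continuous_subtype_val).subtype_mk _

theorem toContStarAutCompact_theta (u : HilbertAut A E) (ξ η : E) :
    (toContStarAutCompact A E u).1 (theta A ξ η) = theta A (u.1 ξ) (u.1 η) :=
  Subtype.ext (conj_rankOne u ξ η)

end Conj

end HilbertAut

/-! ### Inverse limit actions -/

namespace CStarSystem.Limit

variable {Λ : Type*} [Preorder Λ] {S : CStarSystem Λ} {A : Type*} [NonUnitalRing A] [StarRing A]
  [Module ℂ A] [TopologicalSpace A] (P : S.Limit A)

theorem continuous_proj (i : Λ) : Continuous (P.proj i) :=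
  (continuous_apply i).comp P.isInducing.continuous

/-- The C⋆-seminorm `a ↦ ‖proj i a‖` on an inverse limit of C⋆-algebras. -/
def seminorm (i : Λ) : ContCStarSeminorm A :=
  (ContCStarSeminorm.ofNorm (S.alg i)).comp (P.proj i) (P.continuous_proj i)

theorem seminorm_mono : Monotone P.seminorm := fun i j h a => by
  change ‖P.proj i a‖ ≤ ‖P.proj j a‖
  rw [← P.map_proj h]
  exact NonUnitalStarAlgHom.norm_apply_le (S.map h) _

theorem nhds_zero_eq_iInf : 𝓝 (0 : A) = ⨅ i, comap (P.seminorm i) (𝓝 0) := by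
  rw [P.isInducing.nhds_eq_comap, nhds_pi, Filter.pi, comap_iInf]
  refine iInf_congr fun i => ?_
  rw [comap_comap, map_zero, ← comap_norm_nhds_zero, comap_comap]
  rfl

theorem exists_le_seminorm [IsDirectedOrder Λ] [Nonempty Λ] (q : ContCStarSeminorm A) :
    ∃ i, q ≤ P.seminorm i := by
  have hanti : Antitone fun i => comap (P.seminorm i) (𝓝 0) := fun i j h =>
    tendsto_iff_comap.1 (squeeze_zero (apply_nonneg _) (P.seminorm_mono h) tendsto_comap)
  have hq : q ⁻¹' Set.Iio 1 ∈ ⨅ i, comap (P.seminorm i) (𝓝 0) :=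
    P.nhds_zero_eq_iInf ▸ q.tendsto_zero (Iio_mem_nhds one_pos)
  obtain ⟨i, hi⟩ := (mem_iInf_of_directed hanti.directed_ge _).1 hq
  obtain ⟨ε, hε, hball⟩ := (Metric.nhds_basis_ball.comap (P.seminorm i)).mem_iff.1 hi
  refine ⟨i, ContCStarSeminorm.le_of_forall_lt hε fun a ha => hball ?_⟩
  rwa [Set.mem_preimage, mem_ball_zero_iff, Real.norm_of_nonneg (apply_nonneg _ a)]

end CStarSystem.Limit

namespace HilbertAut

open HilbertModule

variable {A E : Type*} [NonUnitalRing A] [StarRing A] [Module ℂ A] [UniformSpace A]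
  [AddCommGroup E] [Module ℂ E] [UniformSpace E] [HilbertModule A E]

section InverseLimit

variable {Λ : Type*} [Preorder Λ] {S : HilbertSystem Λ} {P : S.Limit A E} {i : Λ}
  {u : HilbertAut A E} {u' : HilbertAut (S.alg i) (S.mod i)}

theorem proj_hom (hE : IsFull A E) (h : ∀ ξ, P.mproj i (u.1 ξ) = u'.1 (P.mproj i ξ)) (a : A) :
    P.algLimit.proj i (hom u a) = hom u' (P.algLimit.proj i a) := by
  have hcomp : (P.algLimit.proj i).comp (hom u) = (hom u').comp (P.algLimit.proj i) := by
    refine ext_of_dense_span ((P.algLimit.continuous_proj i).comp (continuous_hom u))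
      ((continuous_hom u').comp (P.algLimit.continuous_proj i)) hE ?_
    rintro _ ⟨x, rfl⟩
    change P.algLimit.proj i (hom u (inner A x.1 x.2)) =
      hom u' (P.algLimit.proj i (inner A x.1 x.2))
    rw [hom_inner, ← P.inner_mproj, ← P.inner_mproj, h, h, hom_inner]
  exact DFunLike.congr_fun hcomp a

theorem seminorm_hom_le (hE : IsFull A E) (h : ∀ ξ, P.mproj i (u.1 ξ) = u'.1 (P.mproj i ξ))
    (a : A) : P.algLimit.seminorm i (hom u a) ≤ P.algLimit.seminorm i a :=
  (congrArg norm (proj_hom hE h a)).trans_le (NonUnitalStarAlgHom.norm_apply_le (hom u') _)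

end InverseLimit

variable [IsLocallyCStarAlgebra A] {G : Type*} [Group G] {u : G →* HilbertAut A E}

theorem eq_toContStarAut (hE : IsFull A E) {α : G →* ContStarAut A}
    (hα : ∀ (g : G) (ξ η : E), (α g).1 (inner A ξ η) = inner A ((u g).1 ξ) ((u g).1 η)) :
    α = (toContStarAut hE).comp u :=
  ContStarAut.eq_of_eqOn_dense_span hE fun g => by
    rintro _ ⟨x, rfl⟩
    exact (hα g x.1 x.2).trans (toContStarAut_inner hE (u g) x.1 x.2).symm

theorem eq_toContStarAutCompact {β : G →* ContStarAut (Compact A E)}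
    (hβ : ∀ (g : G) (ξ η : E), (β g).1 (theta A ξ η) = theta A ((u g).1 ξ) ((u g).1 η)) :
    β = (toContStarAutCompact A E).comp u := by
  let _ := Compact.uniformSpace A E
  have := Compact.isLocallyCStarAlgebra A E
  refine ContStarAut.eq_of_eqOn_dense_span (Compact.dense_span_theta A E) fun g => ?_
  rintro _ ⟨x, rfl⟩
  exact (hβ g x.1 x.2).trans (toContStarAutCompact_theta (u g) x.1 x.2).symm

theorem hasCofinalInvariantSeminorms_toContStarAut (hE : IsFull A E)
    (hu : IsInverseLimitAction.{w, v, x} u) :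
    ContStarAut.HasCofinalInvariantSeminorms ((toContStarAut hE).comp u) := by
  obtain ⟨Λ, _, _, _, S, P, u', -, hu'⟩ := hu
  refine .of_exists_apply_le fun q => ?_
  obtain ⟨i, hi⟩ := P.algLimit.exists_le_seminorm q
  exact ⟨P.algLimit.seminorm i, fun g => seminorm_hom_le hE (hu' g i), hi⟩

theorem exists_invariant_le_seminorm (hE : IsFull A E)
    (hu : ContStarAut.HasCofinalInvariantSeminorms ((toContStarAut hE).comp u))
    (q : ContCStarSeminorm (Compact A E)) : ∃ p : ContCStarSeminorm A,
      (∀ (g : G) (ξ : E), bar p ((u g).1 ξ) = bar p ξ) ∧ q ≤ Compact.seminorm p := by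
  obtain ⟨p, hqp⟩ := Compact.exists_le_seminorm q
  obtain ⟨p', hpp'⟩ := hu.exists_le p
  refine ⟨p'.1, fun g ξ => ?_, hqp.trans (Compact.seminorm_mono hpp')⟩
  rw [bar, bar, ← toContStarAut_inner hE]
  exact congrArg Real.sqrt (p'.2 g _)

theorem hasCofinalInvariantSeminorms_toContStarAutCompact (hE : IsFull A E)
    (hu : ContStarAut.HasCofinalInvariantSeminorms ((toContStarAut hE).comp u)) :
    ContStarAut.HasCofinalInvariantSeminorms ((toContStarAutCompact A E).comp u) :=
  .of_exists_apply_le fun q => (exists_invariant_le_seminorm hE hu q).imp' Compact.seminorm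
    fun _ hp => ⟨fun g T => seminorm_conjCompact_le (hp.1 g) T, hp.2⟩

theorem isContinuousInverseLimitAction_toContStarAut [TopologicalSpace G] (hE : IsFull A E)
    (hu : IsContinuousInverseLimitAction.{w, v, x} u) :
    ContStarAut.IsContinuousInverseLimitAction ((toContStarAut hE).comp u) := by
  have h := hasCofinalInvariantSeminorms_toContStarAut hE hu.2
  refine ⟨h.isContinuousAction hE ?_, h.isInverseLimitAction, h⟩
  rintro _ ⟨x, rfl⟩
  have hcont : Continuous fun g => inner A ((u g).1 x.1) ((u g).1 x.2) :=
    continuous_iff_continuousAt.2 fun g =>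
      tendsto_inner ((hu.1 x.1).tendsto g) ((hu.1 x.2).tendsto g)
  exact hcont.congr fun g => (toContStarAut_inner hE (u g) x.1 x.2).symm

theorem isContinuousInverseLimitAction_toContStarAutCompact [TopologicalSpace G]
    (hE : IsFull A E) (hu : IsContinuousInverseLimitAction.{w, v, x} u) :
    ContStarAut.IsContinuousInverseLimitAction ((toContStarAutCompact A E).comp u) := by
  let _ := Compact.uniformSpace A E
  have := Compact.isLocallyCStarAlgebra A E
  have h := hasCofinalInvariantSeminorms_toContStarAutCompact hE
    (hasCofinalInvariantSeminorms_toContStarAut hE hu.2)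
  refine ⟨h.isContinuousAction (Compact.dense_span_theta A E) ?_, h.isInverseLimitAction, h⟩
  rintro _ ⟨x, rfl⟩
  have hcont : Continuous fun g => theta A ((u g).1 x.1) ((u g).1 x.2) :=
    continuous_iff_continuousAt.2 fun g =>
      Compact.tendsto_theta ((hu.1 x.1).tendsto g) ((hu.1 x.2).tendsto g)
  exact hcont.congr fun g => (toContStarAutCompact_theta (u g) x.1 x.2).symm

end HilbertAut

end

open HilbertAut in
theorem proposition3p8_general {G : Type*} [Group G] [TopologicalSpace G]
    {A : Type*} [NonUnitalRing A] [StarRing A] [Module ℂ A] [UniformSpace A]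
    [IsLocallyCStarAlgebra A]
    {E : Type*} [AddCommGroup E] [Module ℂ E] [UniformSpace E] [HilbertModule A E]
    (hE : HilbertModule.IsFull A E) (u : G →* HilbertAut A E) :
    (∃! α : G →* ContStarAut A,
      ∀ (g : G) (ξ η : E), (α g).1 (inner A ξ η) = inner A ((u g).1 ξ) ((u g).1 η)) ∧
    (∃! β : G →* ContStarAut (HilbertModule.Compact A E),
      ∀ (g : G) (ξ η : E), (β g).1 (HilbertModule.theta A ξ η) =
        HilbertModule.theta A ((u g).1 ξ) ((u g).1 η)) ∧
    (HilbertAut.IsContinuousInverseLimitAction.{w, v, x} u →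
      (∀ α : G →* ContStarAut A,
        (∀ (g : G) (ξ η : E), (α g).1 (inner A ξ η) = inner A ((u g).1 ξ) ((u g).1 η)) →
        ContStarAut.IsContinuousInverseLimitAction α) ∧
      (∀ β : G →* ContStarAut (HilbertModule.Compact A E),
        (∀ (g : G) (ξ η : E), (β g).1 (HilbertModule.theta A ξ η) =
          HilbertModule.theta A ((u g).1 ξ) ((u g).1 η)) →
        ContStarAut.IsContinuousInverseLimitAction β)) := by
  refine ⟨⟨(toContStarAut hE).comp u, fun g => toContStarAut_inner hE (u g),
      fun α hα => eq_toContStarAut hE hα⟩,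
    ⟨(toContStarAutCompact A E).comp u, fun g => toContStarAutCompact_theta (u g),
      fun β hβ => eq_toContStarAutCompact hβ⟩,
    fun hu => ⟨fun α hα => ?_, fun β hβ => ?_⟩⟩
  · rw [eq_toContStarAut hE hα]
    exact isContinuousInverseLimitAction_toContStarAut hE hu
  · rw [eq_toContStarAutCompact hβ]
    exact isContinuousInverseLimitAction_toContStarAutCompact hE hu

theorem proposition3p8 {G : Type*} [Group G] [TopologicalSpace G]
    [IsTopologicalGroup G] [LocallyCompactSpace G]
    {A : Type*} [NonUnitalRing A] [StarRing A] [Module ℂ A] [UniformSpace A]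
    [IsLocallyCStarAlgebra A]
    {E : Type*} [AddCommGroup E] [Module ℂ E] [UniformSpace E] [HilbertModule A E]
    (hE : HilbertModule.IsFull A E) (u : G →* HilbertAut A E) :
    -- the induced action on `A`
    (∃! α : G →* ContStarAut A,
      ∀ (g : G) (ξ η : E), (α g).1 (inner A ξ η) = inner A ((u g).1 ξ) ((u g).1 η)) ∧
    -- the induced action on `K(E)`
    (∃! β : G →* ContStarAut (HilbertModule.Compact A E),
      ∀ (g : G) (ξ η : E), (β g).1 (HilbertModule.theta A ξ η) =
        HilbertModule.theta A ((u g).1 ξ) ((u g).1 η)) ∧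
    -- if `u` is a continuous inverse limit action, then so are the induced actions
    (HilbertAut.IsContinuousInverseLimitAction.{w, v, x} u →
      (∀ α : G →* ContStarAut A,
        (∀ (g : G) (ξ η : E), (α g).1 (inner A ξ η) = inner A ((u g).1 ξ) ((u g).1 η)) →
        ContStarAut.IsContinuousInverseLimitAction α) ∧
      (∀ β : G →* ContStarAut (HilbertModule.Compact A E),
        (∀ (g : G) (ξ η : E), (β g).1 (HilbertModule.theta A ξ η) =
          HilbertModule.theta A ((u g).1 ξ) ((u g).1 η)) →
        ContStarAut.IsContinuousInverseLimitAction β)) :=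
  proposition3p8_general hE u
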